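/- Let $G_0$ be one of the groups $\mathrm{SL}(2,\mathbb R)$, $\mathrm{SL}(2,\mathbb C)$ or $\mathrm{SO}_e(n,1)$ with $n\ge 2$, where $\mathrm{SO}_e(n,1)$ is the identity component of the group $\mathrm{SO}(n,1)$ of real $(n+1)\times(n+1)$ matrices of determinant one preserving $x_1^2+\dots+x_n^2-x_{n+1}^2$. Let $\mathfrak g_0$ be its Lie algebra, regarded as a real Lie algebra of matrices, and let $\mathfrak g_0=\mathfrak k_0\oplus\mathfrak s_0$ be the Cartan decomposition into skew-Hermitian and Hermitian matrices. Let $K_0\subset G_0$ be the maximal compact subgroup of unitary matrices in $G_0$. Put $G=G_0\times G_0\times G_0$, $H=\{(g,g,g): g\in G_0\}$, $K=K_0\times K_0\times K_0$, $\mathfrak g=\mathfrak g_0\times\mathfrak g_0\times\mathfrak g_0$, $\mathfrak h=\{(X,X,X): X\in\mathfrak g_0\}$, $\mathfrak k=\mathfrak k_0\times\mathfrak k_0\times\mathfrak k_0$ and $\mathfrak s=\mathfrak s_0\times\mathfrak s_0\times\mathfrak s_0$. A minimal parabolic subalgebra of $\mathfrak g$ is a subspace $\mathfrak p=\mathfrak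 m'+\mathfrak a'+\mathfrak n'$, where $\mathfrak a'\subset\mathfrak s$ is maximal abelian, $\mathfrak m'$ is the centralizer of $\mathfrak a'$ in $\mathfrak k$, and $\mathfrak n'$ is the sum of the root spaces for a positive system of roots of $\mathfrak a'$ in $\mathfrak g$. Then there exists a maximal abelian subspace $\mathfrak a\subset\mathfrak s$ such that (i) $G=KAH$, where $A=\exp\mathfrak a$, and (ii) $\mathfrak g=\mathfrak p+\mathfrak h$ for every minimal parabolic subalgebra $\mathfrak p$ of $\mathfrak g$ containing $\mathfrak a$. More precisely, there exist pairwise distinct maximal abelian subspaces $\mathfrak a_1,\mathfrak a_2,\mathfrak a_3\subset\mathfrak s_0$ with $\dim_{\mathbb R}(\mathfrak a_1+\mathfrak a_2+\mathfrak a_3)=2$, and for all such $\mathfrak a_1,\mathfrak a_2,\mathfrak a_3$ the subspace $\mathfrak a=\mathfrak a_1\times\mathfrak a_2\times\mathfrak a_3$ is maximal abelian in $\mathfrak s$ and satisfies (i) and (ii). -/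

import Mathlib

open Matrix
open scoped Pointwise

/- Matrices carry the commutator bracket `[X, Y] = XY - YX`. -/
attribute [local instance] LieRing.ofAssociativeRing

namespace TripleSpace

/-! ### Cartan subspaces and minimal parabolic subalgebras of a real Lie algebra -/

section General

variable {L : Type} [LieRing L] [LieAlgebra ℝ L]

/-- `a` is a maximal abelian subspace of the subspace `s` of the Lie algebra `L`: it is maximal
among the linear subspaces of `s` on which the Lie bracket vanishes. -/
def IsMaximalAbelianIn (s a : Submodule ℝ L) : Prop :=
  Maximal (fun b : Submodule ℝ L => b ≤ s ∧ ∀ X ∈ b, ∀ Y ∈ b, ⁅X, Y⁆ = 0) a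

/-- For `α` in the dual of `a`, the joint eigenspace
`L^α = {Y | [X, Y] = α(X) Y for all X ∈ a}`. -/
def rootSpace (a : Submodule ℝ L) (α : Module.Dual ℝ a) : Submodule ℝ L where
  carrier := {Y | ∀ X : a, ⁅(X : L), Y⁆ = α X • Y}
  add_mem' := by
    intro Y Z hY hZ X
    rw [lie_add, hY X, hZ X, smul_add]
  zero_mem' := by
    intro X
    simp
  smul_mem' := by
    intro c Y hY X
    rw [lie_smul, hY X, smul_comm]

/-- `α` is a root of `a`: a nonzero linear form on `a` with nonzero root space. -/
def IsRoot (a : Submodule ℝ L) (α : Module.Dual ℝ a) : Prop :=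
  α ≠ 0 ∧ rootSpace a α ≠ ⊥

/-- `S` is a positive system for the roots of `a`: it consists of the roots that are positive at
some regular element of `a`, i.e. at some element on which no root vanishes. -/
def IsPositiveSystem (a : Submodule ℝ L) (S : Set (Module.Dual ℝ a)) : Prop :=
  ∃ X : a, (∀ α, IsRoot a α → α X ≠ 0) ∧ S = {α | IsRoot a α ∧ 0 < α X}

/-- The centralizer `m` of `a` in the subspace `k`. -/
def centralizerIn (k a : Submodule ℝ L) : Submodule ℝ L where
  carrier := {Y | Y ∈ k ∧ ∀ X ∈ a, ⁅X, Y⁆ = 0}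
  add_mem' := by
    intro Y Z hY hZ
    refine ⟨k.add_mem hY.1 hZ.1, fun X hX => ?_⟩
    rw [lie_add, hY.2 X hX, hZ.2 X hX, add_zero]
  zero_mem' := ⟨k.zero_mem, fun X _ => lie_zero X⟩
  smul_mem' := by
    intro c Y hY
    refine ⟨k.smul_mem c hY.1, fun X hX => ?_⟩
    rw [lie_smul, hY.2 X hX, smul_zero]

/-- Minimal parabolic subalgebras of `L` with respect to a Cartan decomposition `L = k ⊕ s`: the
subspaces `m + a + n`, where `a` is maximal abelian in `s`, `m` is the centralizer of `a` in `k`,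
and `n` is the sum of the root spaces of some positive system for the roots of `a`. -/
def IsMinimalParabolic (k s p : Submodule ℝ L) : Prop :=
  ∃ a : Submodule ℝ L, IsMaximalAbelianIn s a ∧
    ∃ S : Set (Module.Dual ℝ a), IsPositiveSystem a S ∧
      p = centralizerIn k a ⊔ a ⊔ ⨆ α ∈ S, rootSpace a α

end General

/-! ### The threefold product of a Lie algebra, with the componentwise bracket -/

section Product

variable {L : Type} [LieRing L]

instance : LieRing (Fin 3 → L) where
  bracket X Y := fun j => ⁅X j, Y j⁆
  add_lie X Y Z := funext fun j => add_lie (X j) (Y j) (Z j)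
  lie_add X Y Z := funext fun j => lie_add (X j) (Y j) (Z j)
  lie_self X := funext fun j => lie_self (X j)
  leibniz_lie X Y Z := funext fun j => leibniz_lie (X j) (Y j) (Z j)

instance [LieAlgebra ℝ L] : LieAlgebra ℝ (Fin 3 → L) where
  lie_smul t X Y := funext fun j => lie_smul t (X j) (Y j)

end Product

/-! ### The groups `SL(2,ℝ)`, `SL(2,ℂ)`, `SO_e(n,1)` -/

/-- `SO(n,1)`: the real matrices of determinant one preserving the quadratic form
`x₁² + ⋯ + xₙ² - xₙ₊₁²`. -/
def SO (n : ℕ) : Subgroup (SpecialLinearGroup (Fin n ⊕ Fin 1) ℝ) where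
  carrier := {g | (g : Matrix (Fin n ⊕ Fin 1) (Fin n ⊕ Fin 1) ℝ)ᵀ *
    LieAlgebra.Orthogonal.indefiniteDiagonal (Fin n) (Fin 1) ℝ * g =
      LieAlgebra.Orthogonal.indefiniteDiagonal (Fin n) (Fin 1) ℝ}
  mul_mem' := by
    intro g h hg hh
    change (g.1 * h.1)ᵀ * _ * (g.1 * h.1) = _
    change g.1ᵀ * _ * g.1 = _ at hg
    change h.1ᵀ * _ * h.1 = _ at hh
    rw [transpose_mul]
    conv_rhs => rw [← hh, ← hg]
    simp only [Matrix.mul_assoc]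
  one_mem' := by
    change (1 : Matrix (Fin n ⊕ Fin 1) (Fin n ⊕ Fin 1) ℝ)ᵀ * _ * 1 = _
    rw [transpose_one, Matrix.one_mul, Matrix.mul_one]
  inv_mem' := by
    intro g hg
    have h1 : g.1 * (g⁻¹).1 = 1 := congrArg Subtype.val (mul_inv_cancel g)
    have h2 : (g⁻¹).1ᵀ * g.1ᵀ = 1 := by rw [← transpose_mul, h1, transpose_one]
    change g.1ᵀ * _ * g.1 = _ at hg
    change (g⁻¹).1ᵀ * _ * (g⁻¹).1 = _
    conv_lhs => rw [← hg]
    simp only [Matrix.mul_assoc]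
    rw [h1, Matrix.mul_one, ← Matrix.mul_assoc, h2, Matrix.one_mul]

/-- `SO_e(n,1)`: the identity component of `SO(n,1)`. -/
def SOe (n : ℕ) : Subgroup (SpecialLinearGroup (Fin n ⊕ Fin 1) ℝ) :=
  (Subgroup.connectedComponentOfOne (SO n)).map (SO n).subtype

/-- The list of groups `G₀`: `SL(2,ℝ)`, `SL(2,ℂ)`, and `SO_e(n,1)` for `n ≥ 2`. -/
inductive IsListed : ∀ {𝕜 : Type} [RCLike 𝕜] {ι : Type} [Fintype ι] [DecidableEq ι],
    Subgroup (SpecialLinearGroup ι 𝕜) → Prop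
  | sl2R : IsListed (⊤ : Subgroup (SpecialLinearGroup (Fin 2) ℝ))
  | sl2C : IsListed (⊤ : Subgroup (SpecialLinearGroup (Fin 2) ℂ))
  | soe (n : ℕ) (hn : 2 ≤ n) : IsListed (SOe n)

/-! ### Lie algebra and Cartan decomposition of `G₀`, and the triple space -/

section Triple

variable {𝕜 : Type} [RCLike 𝕜] {ι : Type} [Fintype ι] [DecidableEq ι]

/-- The Lie algebra `𝔤₀` of a closed linear group `G₀`, as a real Lie algebra of matrices under
the commutator: the matrices `X` with `exp(tX) ∈ G₀` for all real `t`. (For a closed group these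
matrices already form a real Lie algebra, so taking the span adds nothing.) -/
def lieAlg (G₀ : Subgroup (SpecialLinearGroup ι 𝕜)) : LieSubalgebra ℝ (Matrix ι ι 𝕜) :=
  LieSubalgebra.lieSpan ℝ (Matrix ι ι 𝕜)
    {X | ∀ t : ℝ, ∃ g ∈ G₀, (g : Matrix ι ι 𝕜) = NormedSpace.exp (t • X)}

/-- `𝔨₀`, the `+1` eigenspace in `𝔤₀` of the Cartan involution `X ↦ -X*`. -/
def k₀ (G₀ : Subgroup (SpecialLinearGroup ι 𝕜)) : Submodule ℝ (lieAlg G₀) where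
  carrier := {X | (X : Matrix ι ι 𝕜)ᴴ = -X}
  add_mem' := by
    intro X Y hX hY
    simp only [Set.mem_ofPred_eq] at *
    push_cast
    rw [conjTranspose_add, hX, hY, neg_add]
  zero_mem' := by simp
  smul_mem' := by
    intro c X hX
    simp only [Set.mem_ofPred_eq] at *
    push_cast
    rw [conjTranspose_smul, hX, star_trivial, smul_neg]

/-- `𝔰₀`, the `-1` eigenspace in `𝔤₀` of the Cartan involution `X ↦ -X*`. -/
def s₀ (G₀ : Subgroup (SpecialLinearGroup ι 𝕜)) : Submodule ℝ (lieAlg G₀) where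
  carrier := {X | (X : Matrix ι ι 𝕜)ᴴ = X}
  add_mem' := by
    intro X Y hX hY
    simp only [Set.mem_ofPred_eq] at *
    push_cast
    rw [conjTranspose_add, hX, hY]
  zero_mem' := by simp
  smul_mem' := by
    intro c X hX
    simp only [Set.mem_ofPred_eq] at *
    push_cast
    rw [conjTranspose_smul, hX, star_trivial]

/-- The maximal compact subgroup `K₀` of `G₀` with Lie algebra `𝔨₀`: the unitary (orthogonal)
matrices in `G₀`. -/
def K₀ (G₀ : Subgroup (SpecialLinearGroup ι 𝕜)) : Subgroup G₀ where
  carrier := {g | ((g : SpecialLinearGroup ι 𝕜) : Matrix ι ι 𝕜) ∈ unitary (Matrix ι ι 𝕜)}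
  mul_mem' := by
    intro g h hg hh
    exact (unitary (Matrix ι ι 𝕜)).mul_mem hg hh
  one_mem' := one_mem (unitary (Matrix ι ι 𝕜))
  inv_mem' := by
    intro g hg
    have hg' : g.1.1 ∈ unitary (Matrix ι ι 𝕜) := hg
    have h1 : g.1.1 * (g⁻¹).1.1 = 1 :=
      congrArg (fun x : G₀ => x.1.1) (mul_inv_cancel g)
    have h2 : (g⁻¹).1.1 = star g.1.1 := by
      rw [← Matrix.one_mul (g⁻¹).1.1, ← (Unitary.mem_iff.mp hg').1, Matrix.mul_assoc, h1,
        Matrix.mul_one]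
    change (g⁻¹).1.1 ∈ unitary (Matrix ι ι 𝕜)
    rw [h2]
    exact Unitary.star_mem hg'

/-- `V₁ × V₂ × V₃` as a subspace of `𝔤 = 𝔤₀ × 𝔤₀ × 𝔤₀`. -/
def prod₃ {L : Type} [AddCommGroup L] [Module ℝ L] (V : Fin 3 → Submodule ℝ L) :
    Submodule ℝ (Fin 3 → L) :=
  Submodule.pi Set.univ V

/-- The diagonal `𝔥` of `𝔤 = 𝔤₀ × 𝔤₀ × 𝔤₀`. -/
def diagonal (L : Type) [AddCommGroup L] [Module ℝ L] : Submodule ℝ (Fin 3 → L) :=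
  LinearMap.range (LinearMap.pi (fun _ : Fin 3 => (LinearMap.id : L →ₗ[ℝ] L)))

/-- `K = K₀ × K₀ × K₀` as a subgroup of `G = G₀ × G₀ × G₀`. -/
def K (G₀ : Subgroup (SpecialLinearGroup ι 𝕜)) : Subgroup (Fin 3 → G₀) :=
  Subgroup.pi Set.univ (fun _ => K₀ G₀)

/-- `H`, the diagonal of `G = G₀ × G₀ × G₀`. -/
def H (G₀ : Subgroup (SpecialLinearGroup ι 𝕜)) : Subgroup (Fin 3 → G₀) :=
  (Pi.constMonoidHom (Fin 3) G₀).range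

/-- `exp 𝔞 ⊆ G = G₀ × G₀ × G₀` for a subspace `𝔞` of `𝔤 = 𝔤₀ × 𝔤₀ × 𝔤₀`. -/
def expSet (G₀ : Subgroup (SpecialLinearGroup ι 𝕜)) (a : Submodule ℝ (Fin 3 → lieAlg G₀)) :
    Set (Fin 3 → G₀) :=
  {g | ∃ X ∈ a, ∀ j, ((g j : SpecialLinearGroup ι 𝕜) : Matrix ι ι 𝕜) =
    NormedSpace.exp (X j : Matrix ι ι 𝕜)}

/-- The polar decomposition `G = K A H` with `A = exp 𝔞`. -/
def PolarDecomposition (G₀ : Subgroup (SpecialLinearGroup ι 𝕜))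
    (a : Submodule ℝ (Fin 3 → lieAlg G₀)) : Prop :=
  (K G₀ : Set (Fin 3 → G₀)) * expSet G₀ a * (H G₀ : Set (Fin 3 → G₀)) = Set.univ

/-- The spherical decomposition `𝔤 = 𝔭 + 𝔥`. -/
def SphericalDecomposition (G₀ : Subgroup (SpecialLinearGroup ι 𝕜))
    (p : Submodule ℝ (Fin 3 → lieAlg G₀)) : Prop :=
  p ⊔ diagonal (lieAlg G₀) = ⊤

/-- `𝔞₁, 𝔞₂, 𝔞₃` are pairwise distinct maximal abelian subspaces of `𝔰₀` whose sum has real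
dimension two. -/
def IsPlanarTriple (G₀ : Subgroup (SpecialLinearGroup ι 𝕜))
    (a : Fin 3 → Submodule ℝ (lieAlg G₀)) : Prop :=
  (∀ j, IsMaximalAbelianIn (s₀ G₀) (a j)) ∧ Function.Injective a ∧
    Module.finrank ℝ (⨆ j, a j : Submodule ℝ (lieAlg G₀)) = 2

end Triple

end TripleSpace

/-! Every listed group acts on Lorentz space `ℝⁿ ⊕ ℝ` so that `𝔤₀` becomes `𝔰𝔬(n,1)` and the
stabilizer of the base point `o = (0, 1)` of hyperbolic space lies in `K₀`. For `SO_e(n,1)` this is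
the standard representation; for `SL(2,ℝ)` and `SL(2,ℂ)` it is `N ↦ g N g*` on Hermitian matrices,
with `n = 2` and `n = 3`. `LorentzModel` records what is needed, and the theorem is proved once for
any such model. The rank is one: maximal abelian subspaces of `𝔰₀` are lines of boosts, so a planar
triple is three distinct lines in a plane spanned by orthonormal `e, f`.

Polar part: `G = KAH` says that any three points of hyperbolic space can be moved by a single `h`
onto the three geodesics through `o` with directions in the `𝔞ⱼ`. Move the first point to `o` and
rotate the other two into the hyperbolic plane of `e, f`. Rotate by `θ` in this plane, then
translate along `e`; the first point stays on its geodesic. For each of the other points a unique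
translation length brings it to its geodesic. This length changes sign under `θ ↦ θ + π`, hence so
does the difference of the two lengths, which therefore vanishes for some `θ`
(`exists_rotation_boost`, `exists_move_to_geodesics`).

Spherical part: a minimal parabolic subalgebra is the stabilizer of three null lines
(`exists_mem_iff_of_isMinimalParabolic`). If it contains `𝔞`, these lines are distinct, and `𝔤 = 𝔭 +
𝔥` says that `𝔰𝔬(n,1)` moves them infinitesimally in all directions independently. This is linear
algebra in the span of the three null vectors (`exists_gen_of_null`). -/

namespace TripleSpace

/-! ### One-parameter groups of matrices and linear differential equations. -/

section ExpFlow

variable {𝕜 : Type} [RCLike 𝕜] {ι : Type} [Fintype ι] [DecidableEq ι]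

theorem hasDerivAt_exp_smul_apply (X : Matrix ι ι 𝕜) (t : ℝ) (i j : ι) :
    HasDerivAt (fun t : ℝ => (NormedSpace.exp (t • X) : Matrix ι ι 𝕜) i j)
      ((X * NormedSpace.exp (t • X)) i j) t := by
  let _ : NormedRing (Matrix ι ι 𝕜) := Matrix.linftyOpNormedRing
  let _ : NormedAlgebra ℝ (Matrix ι ι 𝕜) := Matrix.linftyOpNormedAlgebra
  have h := hasDerivAt_exp_smul_const' (𝕂 := ℝ) X t
  let L : Matrix ι ι 𝕜 →ₗ[ℝ] 𝕜 :=
    { toFun := fun M => M i j, map_add' := fun _ _ => rfl, map_smul' := fun _ _ => rfl }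
  exact (LinearMap.toContinuousLinearMap L).hasFDerivAt.comp_hasDerivAt t h

theorem hasDerivAt_exp_smul_apply' (X : Matrix ι ι 𝕜) (t : ℝ) (i j : ι) :
    HasDerivAt (fun t : ℝ => (NormedSpace.exp (t • X) : Matrix ι ι 𝕜) i j)
      ((NormedSpace.exp (t • X) * X) i j) t := by
  let _ : NormedRing (Matrix ι ι 𝕜) := Matrix.linftyOpNormedRing
  let _ : NormedAlgebra ℝ (Matrix ι ι 𝕜) := Matrix.linftyOpNormedAlgebra
  have h := hasDerivAt_exp_smul_const (𝕂 := ℝ) X t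
  let L : Matrix ι ι 𝕜 →ₗ[ℝ] 𝕜 :=
    { toFun := fun M => M i j, map_add' := fun _ _ => rfl, map_smul' := fun _ _ => rfl }
  exact (LinearMap.toContinuousLinearMap L).hasFDerivAt.comp_hasDerivAt t h

theorem exp_neg_mul_exp (X : Matrix ι ι 𝕜) :
    (NormedSpace.exp (-X) : Matrix ι ι 𝕜) * NormedSpace.exp X = 1 := by
  have h := Matrix.exp_add_of_commute (-X) X (Commute.neg_left (Commute.refl X))
  rw [neg_add_cancel, NormedSpace.exp_zero] at h
  exact h.symm

theorem exp_mul_exp_neg (X : Matrix ι ι 𝕜) :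
    (NormedSpace.exp X : Matrix ι ι 𝕜) * NormedSpace.exp (-X) = 1 := by
  simpa using exp_neg_mul_exp (-X)

/-- A solution of the linear system `c' = X c` is given by the matrix exponential. -/
theorem exp_smul_mulVec_eq (X : Matrix ι ι ℝ) (c : ℝ → ι → ℝ)
    (hc : ∀ t i, HasDerivAt (fun t => c t i) ((X *ᵥ c t) i) t) (t : ℝ) :
    NormedSpace.exp (t • X) *ᵥ c 0 = c t := by
  -- The curve `exp(-uX) c(u)` has derivative zero.
  have k : NormedSpace.exp (t • -X) *ᵥ c t = NormedSpace.exp ((0 : ℝ) • -X) *ᵥ c 0 := by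
    funext i
    have hd : ∀ u : ℝ, HasDerivAt (fun u => (NormedSpace.exp (u • -X) *ᵥ c u) i) 0 u := by
      intro u
      have h := HasDerivAt.fun_sum (u := Finset.univ) (fun j _ =>
        (hasDerivAt_exp_smul_apply' (-X) u i j).mul (hc u j))
      refine h.congr_deriv ?_
      have e : (NormedSpace.exp (u • -X) * -X) *ᵥ c u + NormedSpace.exp (u • -X) *ᵥ (X *ᵥ c u)
          = 0 := by
        rw [mulVec_mulVec, ← add_mulVec, ← mul_add, neg_add_cancel, mul_zero, zero_mulVec]
      have e' := congrFun e i
      rw [Finset.sum_add_distrib]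
      exact e'
    exact is_const_of_deriv_eq_zero (fun u => (hd u).differentiableAt) (fun u => (hd u).deriv) t 0
  rw [zero_smul, NormedSpace.exp_zero, one_mulVec] at k
  rw [← k, mulVec_mulVec, smul_neg, exp_mul_exp_neg, one_mulVec]

end ExpFlow

/-! ### The Lorentz space `ℝⁿ ⊕ ℝ` and its Lie algebra -/

section Lorentz

variable {n : ℕ}

/-- The vector of `ℝⁿ ⊕ ℝ` with space part `ξ` and time part `t`. -/
def vec (ξ : Fin n → ℝ) (t : ℝ) : Fin n ⊕ Fin 1 → ℝ := Sum.elim ξ (fun _ => t)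

/-- The block matrix with space part `R`, boost part `v` and zero time part. -/
def gen (R : Matrix (Fin n) (Fin n) ℝ) (v : Fin n → ℝ) :
    Matrix (Fin n ⊕ Fin 1) (Fin n ⊕ Fin 1) ℝ :=
  fromBlocks R (replicateCol (Fin 1) v) (replicateRow (Fin 1) v) 0

/-- The skew matrix `x ↦ (v·x) u - (u·x) v`. -/
def wedge (u v : Fin n → ℝ) : Matrix (Fin n) (Fin n) ℝ := vecMulVec u v - vecMulVec v u

theorem vec_inj {ξ η : Fin n → ℝ} {s t : ℝ} : vec ξ s = vec η t ↔ ξ = η ∧ s = t := by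
  constructor
  · intro h
    exact ⟨funext fun i => congrFun h (Sum.inl i), congrFun h (Sum.inr 0)⟩
  · rintro ⟨rfl, rfl⟩; rfl

theorem vec_surj (x : Fin n ⊕ Fin 1 → ℝ) : ∃ ξ t, x = vec ξ t :=
  ⟨fun i => x (Sum.inl i), x (Sum.inr 0), by
    funext i; rcases i with i | i
    · rfl
    · fin_cases i; rfl⟩

theorem vec_add (ξ η : Fin n → ℝ) (s t : ℝ) : vec ξ s + vec η t = vec (ξ + η) (s + t) := by
  funext i; rcases i with i | i <;> rfl

theorem vec_sub (ξ η : Fin n → ℝ) (s t : ℝ) : vec ξ s - vec η t = vec (ξ - η) (s - t) := by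
  funext i; rcases i with i | i <;> rfl

theorem smul_vec (c : ℝ) (ξ : Fin n → ℝ) (t : ℝ) : c • vec ξ t = vec (c • ξ) (c * t) := by
  funext i; rcases i with i | i <;> rfl

theorem gen_mulVec (R : Matrix (Fin n) (Fin n) ℝ) (v ξ : Fin n → ℝ) (t : ℝ) :
    gen R v *ᵥ vec ξ t = vec (R *ᵥ ξ + t • v) (v ⬝ᵥ ξ) := by
  rw [gen, fromBlocks_mulVec, vec, vec]
  funext i
  rcases i with i | i
  · simp [mulVec, dotProduct, mul_comm]
  · simp [mulVec, dotProduct, replicateRow]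

theorem wedge_mulVec (u v x : Fin n → ℝ) : wedge u v *ᵥ x = (v ⬝ᵥ x) • u - (u ⬝ᵥ x) • v := by
  simp [wedge, sub_mulVec, vecMulVec_mulVec]

theorem wedge_transpose (u v : Fin n → ℝ) : (wedge u v)ᵀ = -wedge u v := by
  simp [wedge, transpose_vecMulVec]

theorem gen_inj {R S : Matrix (Fin n) (Fin n) ℝ} {v w : Fin n → ℝ} :
    gen R v = gen S w ↔ R = S ∧ v = w := by
  constructor
  · intro h
    rw [gen, gen, fromBlocks_inj] at h
    exact ⟨h.1, replicateCol_injective h.2.1⟩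
  · rintro ⟨rfl, rfl⟩; rfl

theorem gen_add (R S : Matrix (Fin n) (Fin n) ℝ) (v w : Fin n → ℝ) :
    gen R v + gen S w = gen (R + S) (v + w) := by
  rw [gen, gen, gen, fromBlocks_add, replicateCol_add, replicateRow_add, add_zero]

theorem smul_gen (c : ℝ) (R : Matrix (Fin n) (Fin n) ℝ) (v : Fin n → ℝ) :
    c • gen R v = gen (c • R) (c • v) := by
  rw [gen, gen, fromBlocks_smul, replicateCol_smul, replicateRow_smul, smul_zero]

theorem gen_zero : gen (0 : Matrix (Fin n) (Fin n) ℝ) 0 = 0 := by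
  simpa using (smul_gen (0 : ℝ) (0 : Matrix (Fin n) (Fin n) ℝ) 0).symm

theorem dotProduct_mulVec_of_skew {R : Matrix (Fin n) (Fin n) ℝ} (hR : Rᵀ = -R)
    (x y : Fin n → ℝ) : x ⬝ᵥ (R *ᵥ y) = -((R *ᵥ x) ⬝ᵥ y) := by
  rw [dotProduct_mulVec, ← mulVec_transpose, hR, neg_mulVec, neg_dotProduct]

/-- Two boosts bracket to an infinitesimal rotation, so commuting boosts are parallel and boosts
generate all rotations. Skewness makes the last row of the commutator agree with its last column. -/
theorem lie_gen {R S : Matrix (Fin n) (Fin n) ℝ} (hR : Rᵀ = -R) (hS : Sᵀ = -S)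
    (v w : Fin n → ℝ) :
    ⁅gen R v, gen S w⁆ = gen (⁅R, S⁆ + wedge v w) (R *ᵥ w - S *ᵥ v) := by
  apply Matrix.ext_of_mulVec_single
  intro i
  obtain ⟨ξ, t, h⟩ := vec_surj (Pi.single i (1 : ℝ))
  rw [h, Ring.lie_def, sub_mulVec, ← mulVec_mulVec, ← mulVec_mulVec]
  simp only [gen_mulVec, vec_sub, vec_inj, Ring.lie_def, add_mulVec, sub_mulVec, wedge_mulVec,
    mulVec_add, mulVec_smul, dotProduct_add, dotProduct_smul, sub_dotProduct, ← mulVec_mulVec,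
    dotProduct_mulVec_of_skew hR, dotProduct_mulVec_of_skew hS, dotProduct_comm w v]
  refine ⟨?_, ?_⟩
  · module
  · ring

/-- The infinitesimal rotation of a plane integrates to the rotation group of that plane. -/
theorem exp_rotation {e f : Fin n → ℝ} (he : e ⬝ᵥ e = 1) (hf : f ⬝ᵥ f = 1) (hef : e ⬝ᵥ f = 0)
    {η : Fin n → ℝ} (hη : e ⬝ᵥ η = 0) (hη' : f ⬝ᵥ η = 0) (a b t θ : ℝ) :
    NormedSpace.exp (θ • gen (wedge f e) 0) *ᵥ vec (a • e + b • f + η) t =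
      vec ((a * Real.cos θ - b * Real.sin θ) • e + (a * Real.sin θ + b * Real.cos θ) • f + η) t := by
  have h := exp_smul_mulVec_eq (gen (wedge f e) 0) (fun θ =>
    vec ((a * Real.cos θ - b * Real.sin θ) • e + (a * Real.sin θ + b * Real.cos θ) • f + η) t)
    (by
      intro u i
      rw [gen_mulVec]
      have hfe : f ⬝ᵥ e = 0 := by rw [dotProduct_comm, hef]
      simp only [wedge_mulVec, dotProduct_add, dotProduct_smul, he, hf, hef, hfe, hη, hη',
        zero_dotProduct, smul_zero, add_zero]
      rcases i with i | i
      · simp only [vec, Sum.elim_inl, Pi.add_apply, Pi.smul_apply, Pi.sub_apply, smul_eq_mul]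
        have hc := Real.hasDerivAt_cos u
        have hs := Real.hasDerivAt_sin u
        refine (((((hc.const_mul a).sub (hs.const_mul b)).mul_const (e i)).add
          (((hs.const_mul a).add (hc.const_mul b)).mul_const (f i))).add_const (η i)).congr_deriv ?_
        ring
      · exact hasDerivAt_const u t) θ
  simpa using h

/-- A boost is a hyperbolic rotation in the plane of `v` and the time axis and fixes the spatial
vectors orthogonal to `v`. -/
theorem exp_boost {v : Fin n → ℝ} (hv : v ⬝ᵥ v = 1) {η : Fin n → ℝ} (hη : v ⬝ᵥ η = 0)
    (a t s : ℝ) :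
    NormedSpace.exp (s • gen 0 v) *ᵥ vec (a • v + η) t =
      vec ((a * Real.cosh s + t * Real.sinh s) • v + η) (a * Real.sinh s + t * Real.cosh s) := by
  have h := exp_smul_mulVec_eq (gen 0 v) (fun s =>
    vec ((a * Real.cosh s + t * Real.sinh s) • v + η) (a * Real.sinh s + t * Real.cosh s))
    (by
      intro u i
      rw [gen_mulVec]
      have hc := Real.hasDerivAt_cosh u
      have hs := Real.hasDerivAt_sinh u
      simp only [dotProduct_add, dotProduct_smul, hv, hη, zero_mulVec, zero_add, add_zero]
      rcases i with i | i
      · simp only [vec, Sum.elim_inl, Pi.add_apply, Pi.smul_apply, smul_eq_mul]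
        refine ((((hc.const_mul a).add (hs.const_mul t)).mul_const (v i)).add_const
          (η i)).congr_deriv ?_
        ring
      · simp only [vec, Sum.elim_inr, smul_eq_mul, mul_one]
        exact (hs.const_mul a).add (hc.const_mul t)) s
  simpa using h

end Lorentz

/-! ### Lorentz models -/

/-- A realization of `G₀` by Lorentz transformations of `ℝⁿ ⊕ ℝ` which identifies `𝔤₀` with
`𝔰𝔬(n,1)`, and `K₀` with the stabilizer of the base point `(0, 1)` of hyperbolic space. -/
structure LorentzModel {𝕜 : Type} [RCLike 𝕜] {ι : Type} [Fintype ι] [DecidableEq ι]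
    (G₀ : Subgroup (SpecialLinearGroup ι 𝕜)) (n : ℕ) where
  /-- The action of the group. -/
  rep : G₀ →* Matrix (Fin n ⊕ Fin 1) (Fin n ⊕ Fin 1) ℝ
  /-- The action of the Lie algebra. -/
  drep : lieAlg G₀ →ₗ⁅ℝ⁆ Matrix (Fin n ⊕ Fin 1) (Fin n ⊕ Fin 1) ℝ
  inj : Function.Injective drep
  exists_eq_gen : ∀ X, ∃ R v, Rᵀ = -R ∧ drep X = gen R v
  surj : ∀ (R : Matrix (Fin n) (Fin n) ℝ) v, Rᵀ = -R → ∃ X, drep X = gen R v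
  mem_k₀ : ∀ X, X ∈ k₀ G₀ ↔ ∃ R, drep X = gen R 0
  mem_s₀ : ∀ X, X ∈ s₀ G₀ ↔ ∃ v, drep X = gen 0 v
  exists_exp : ∀ X : lieAlg G₀, ∃ g : G₀,
    ((g : SpecialLinearGroup ι 𝕜) : Matrix ι ι 𝕜) = NormedSpace.exp (X : Matrix ι ι 𝕜) ∧
      rep g = NormedSpace.exp (drep X)
  orbit : ∀ g, ∃ ξ t, rep g *ᵥ vec 0 1 = vec ξ t ∧ 0 < t ∧ t ^ 2 = 1 + ξ ⬝ᵥ ξ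
  stab : ∀ g, rep g *ᵥ vec 0 1 = vec 0 1 → g ∈ K₀ G₀

/-! ### Maximal abelian subspaces of a threefold product. -/

section ProductAbelian

variable {L : Type} [LieRing L] [LieAlgebra ℝ L]

/-- Adjoining `Y` to `a` keeps it abelian and inside `s`. -/
theorem IsMaximalAbelianIn.mem_of_commute {s a : Submodule ℝ L} (h : IsMaximalAbelianIn s a)
    {Y : L} (hY : Y ∈ s) (hc : ∀ X ∈ a, ⁅X, Y⁆ = 0) : Y ∈ a := by
  have hle : a ⊔ Submodule.span ℝ {Y} ≤ a := by
    refine h.2 ⟨sup_le h.1.1 ?_, ?_⟩ le_sup_left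
    · rw [Submodule.span_le]; simpa using hY
    · intro U hU V hV
      obtain ⟨U₁, hU₁, U₂, hU₂, rfl⟩ := Submodule.mem_sup.1 hU
      obtain ⟨V₁, hV₁, V₂, hV₂, rfl⟩ := Submodule.mem_sup.1 hV
      obtain ⟨c, rfl⟩ := Submodule.mem_span_singleton.1 hU₂
      obtain ⟨d, rfl⟩ := Submodule.mem_span_singleton.1 hV₂
      have h1 : ⁅Y, V₁⁆ = 0 := by rw [← lie_skew, hc V₁ hV₁, neg_zero]
      simp [h.1.2 U₁ hU₁ V₁ hV₁, hc U₁ hU₁, h1]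
  exact hle (Submodule.mem_sup_right (Submodule.mem_span_singleton_self Y))

theorem mem_prod₃ {V : Fin 3 → Submodule ℝ L} {X : Fin 3 → L} :
    X ∈ prod₃ V ↔ ∀ j, X j ∈ V j := by
  simp [prod₃, Submodule.mem_pi]

theorem single_mem_prod₃ {V : Fin 3 → Submodule ℝ L} {j : Fin 3} {X : L} (hX : X ∈ V j) :
    (Pi.single j X : Fin 3 → L) ∈ prod₃ V := by
  rw [mem_prod₃]
  intro i
  by_cases h : i = j
  · subst h; simpa using hX
  · rw [Pi.single_eq_of_ne h]; exact (V i).zero_mem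

omit [LieAlgebra ℝ L] in
theorem lie_apply (X Y : Fin 3 → L) (j : Fin 3) : ⁅X, Y⁆ j = ⁅X j, Y j⁆ := rfl

omit [LieAlgebra ℝ L] in
theorem lie_single (X : Fin 3 → L) (j : Fin 3) (Y : L) :
    ⁅X, (Pi.single j Y : Fin 3 → L)⁆ = Pi.single j ⁅X j, Y⁆ := by
  funext i
  rw [lie_apply]
  by_cases h : i = j
  · subst h; simp
  · rw [Pi.single_eq_of_ne h, Pi.single_eq_of_ne h, lie_zero]

theorem isMaximalAbelianIn_prod₃ {s : Submodule ℝ L} {a : Fin 3 → Submodule ℝ L}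
    (h : ∀ j, IsMaximalAbelianIn s (a j)) :
    IsMaximalAbelianIn (prod₃ fun _ => s) (prod₃ a) := by
  refine ⟨⟨fun X hX => mem_prod₃.2 fun j => (h j).1.1 (mem_prod₃.1 hX j), fun X hX Y hY =>
    funext fun j => (h j).1.2 _ (mem_prod₃.1 hX j) _ (mem_prod₃.1 hY j)⟩, ?_⟩
  rintro b ⟨hb, hab⟩ hle Y hY
  refine mem_prod₃.2 fun j => (h j).mem_of_commute (mem_prod₃.1 (hb hY) j) fun X hX => ?_
  have := congrFun (hab _ (hle (single_mem_prod₃ hX)) Y hY) j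
  simpa [lie_apply] using this

theorem IsMaximalAbelianIn.exists_eq_prod₃ {s : Submodule ℝ L} {a : Submodule ℝ (Fin 3 → L)}
    (h : IsMaximalAbelianIn (prod₃ fun _ => s) a) :
    ∃ b : Fin 3 → Submodule ℝ L, (∀ j, IsMaximalAbelianIn s (b j)) ∧ a = prod₃ b := by
  -- The bracket is componentwise, so an element supported in one factor commutes with `a` once it
  -- commutes with the projection of `a` to that factor. Hence the projections are maximal and `a`
  -- is their product.
  have hs : ∀ j (X : L), X ∈ s → (∀ Y ∈ a, ⁅Y j, X⁆ = 0) → (Pi.single j X : Fin 3 → L) ∈ a := by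
    intro j X hX hc
    refine h.mem_of_commute (single_mem_prod₃ (V := fun _ => s) hX) fun Y hY => ?_
    rw [lie_single, hc Y hY, Pi.single_zero]
  let b : Fin 3 → Submodule ℝ L := fun j => a.map (LinearMap.proj j)
  have hb : ∀ j (X : L), X ∈ b j ↔ ∃ Y ∈ a, Y j = X := fun j X => Submodule.mem_map
  have hbs : ∀ j, b j ≤ s := by
    intro j X hX
    obtain ⟨Y, hY, rfl⟩ := (hb j X).1 hX
    exact mem_prod₃.1 (h.1.1 hY) j
  have hbc : ∀ j, ∀ X ∈ b j, ∀ Y ∈ b j, ⁅X, Y⁆ = 0 := by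
    intro j X hX Y hY
    obtain ⟨U, hU, rfl⟩ := (hb j X).1 hX
    obtain ⟨V, hV, rfl⟩ := (hb j Y).1 hY
    exact congrFun (h.1.2 U hU V hV) j
  refine ⟨b, fun j => ⟨⟨hbs j, hbc j⟩, ?_⟩, ?_⟩
  · rintro c ⟨hc, hcc⟩ hle X hX
    exact (hb j X).2 ⟨Pi.single j X, hs j X (hc hX) fun Y hY =>
      hcc _ (hle ((hb j _).2 ⟨Y, hY, rfl⟩)) X hX, by simp⟩
  · have hle : a ≤ prod₃ b := fun Y hY => mem_prod₃.2 fun j => (hb j _).2 ⟨Y, hY, rfl⟩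
    refine le_antisymm hle (h.2 ⟨fun X hX => mem_prod₃.2 fun j => hbs j (mem_prod₃.1 hX j), ?_⟩ hle)
    exact fun X hX Y hY => funext fun j => hbc j _ (mem_prod₃.1 hX j) _ (mem_prod₃.1 hY j)

end ProductAbelian

/-! ### Elementary Euclidean geometry. -/

section Vectors

variable {n : ℕ}

theorem exists_normalize {v : Fin n → ℝ} (hv : v ≠ 0) :
    ∃ c : ℝ, 0 < c ∧ ∃ e : Fin n → ℝ, e ⬝ᵥ e = 1 ∧ v = c • e := by
  have h : 0 < v ⬝ᵥ v := lt_of_le_of_ne (Finset.sum_nonneg fun i _ => mul_self_nonneg _)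
    fun h => hv (dotProduct_self_eq_zero.1 h.symm)
  have hs := Real.sqrt_pos.2 h
  refine ⟨√(v ⬝ᵥ v), hs, (√(v ⬝ᵥ v))⁻¹ • v, ?_, by rw [smul_smul, mul_inv_cancel₀ hs.ne', one_smul]⟩
  rw [smul_dotProduct, dotProduct_smul, smul_eq_mul, smul_eq_mul, ← mul_assoc, ← mul_inv,
    Real.mul_self_sqrt h.le, inv_mul_cancel₀ h.ne']

theorem eq_of_dotProduct_eq_one {v w : Fin n → ℝ} (hv : v ⬝ᵥ v = 1) (hw : w ⬝ᵥ w = 1)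
    (h : v ⬝ᵥ w = 1) : v = w := by
  rw [← sub_eq_zero, ← dotProduct_self_eq_zero]
  simp only [sub_dotProduct, dotProduct_sub, hv, hw, h, dotProduct_comm w v]
  norm_num

/-- Supplies a nonzero root vector for each boost direction. -/
theorem exists_orthogonal (hn : 2 ≤ n) (w : Fin n → ℝ) : ∃ u : Fin n → ℝ, u ≠ 0 ∧ u ⬝ᵥ w = 0 := by
  let i : Fin n := ⟨0, by omega⟩
  let j : Fin n := ⟨1, by omega⟩
  have hij : i ≠ j := by simp [i, j]
  by_cases h : w i = 0
  · refine ⟨Pi.single i 1, by simp, by simp [h]⟩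
  · refine ⟨Pi.single j (w i) - Pi.single i (w j), fun h' => h ?_, ?_⟩
    · have := congrFun h' j
      simpa [hij.symm] using this
    · simp [sub_dotProduct, mul_comm]

end Vectors

/-! ### Rank one: maximal abelian subspaces of `𝔰₀` and planar triples. -/

namespace LorentzModel

variable {𝕜 : Type} [RCLike 𝕜] {ι : Type} [Fintype ι] [DecidableEq ι]
  {G₀ : Subgroup (SpecialLinearGroup ι 𝕜)} {n : ℕ} (M : LorentzModel G₀ n)

/-- The bracket of two boosts is `wedge v w`; applying it to the unit vector `v` shows that `w` is a
multiple of `v`. -/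
theorem eq_smul_of_lie_eq_zero {v w : Fin n → ℝ} {X Y : lieAlg G₀} (hv : v ⬝ᵥ v = 1)
    (hX : M.drep X = gen 0 v) (hY : M.drep Y = gen 0 w) (h : ⁅X, Y⁆ = 0) :
    Y = (v ⬝ᵥ w) • X := by
  have h1 := congrArg M.drep h
  rw [LieHom.map_lie, hX, hY, lie_gen (by simp) (by simp), map_zero, ← gen_zero, gen_inj] at h1
  have h2 := congrArg (fun A => A *ᵥ v) h1.1
  simp only [zero_mulVec, lie_self, zero_add, wedge_mulVec, hv, one_smul] at h2
  apply M.inj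
  rw [map_smul, hX, hY, smul_gen, smul_zero, gen_inj]
  exact ⟨rfl, by rw [← dotProduct_comm w v]; exact (sub_eq_zero.1 h2).symm⟩

theorem isMaximalAbelianIn_span {v : Fin n → ℝ} {X : lieAlg G₀} (hv : v ⬝ᵥ v = 1)
    (hX : M.drep X = gen 0 v) : IsMaximalAbelianIn (s₀ G₀) (Submodule.span ℝ {X}) := by
  refine ⟨⟨?_, ?_⟩, ?_⟩
  · rw [Submodule.span_le, Set.singleton_subset_iff]
    exact (M.mem_s₀ X).2 ⟨v, hX⟩
  · intro U hU V hV
    obtain ⟨c, rfl⟩ := Submodule.mem_span_singleton.1 hU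
    obtain ⟨d, rfl⟩ := Submodule.mem_span_singleton.1 hV
    simp
  · rintro b ⟨hb, hbc⟩ hle Y hY
    obtain ⟨w, hw⟩ := (M.mem_s₀ Y).1 (hb hY)
    exact Submodule.mem_span_singleton.2 ⟨v ⬝ᵥ w, (M.eq_smul_of_lie_eq_zero hv hX hw
      (hbc X (hle (Submodule.mem_span_singleton_self X)) Y hY)).symm⟩

theorem exists_of_isMaximalAbelianIn (hn : 2 ≤ n) {a : Submodule ℝ (lieAlg G₀)}
    (ha : IsMaximalAbelianIn (s₀ G₀) a) :
    ∃ v X, v ⬝ᵥ v = 1 ∧ M.drep X = gen 0 v ∧ a = Submodule.span ℝ {X} := by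
  have hne : a ≠ ⊥ := by
    rintro rfl
    -- The zero subspace is not maximal: every boost commutes with it.
    obtain ⟨X, hX⟩ := M.surj 0 (Pi.single ⟨0, by omega⟩ 1) (by simp)
    have h0 : X ∈ (⊥ : Submodule ℝ (lieAlg G₀)) :=
      ha.mem_of_commute ((M.mem_s₀ X).2 ⟨_, hX⟩) (by simp)
    rw [Submodule.mem_bot] at h0
    rw [h0, map_zero, ← gen_zero, gen_inj] at hX
    exact one_ne_zero ((by simpa using congrFun hX.2 ⟨0, by omega⟩ : (0 : ℝ) = 1).symm)
  obtain ⟨Y, hY, hY0⟩ := Submodule.exists_mem_ne_zero_of_ne_bot hne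
  obtain ⟨w, hw⟩ := (M.mem_s₀ Y).1 (ha.1.1 hY)
  have hw0 : w ≠ 0 := by
    rintro rfl
    exact hY0 (M.inj (by rw [hw, gen_zero, map_zero]))
  obtain ⟨c, hc, v, hv, rfl⟩ := exists_normalize hw0
  have hX : M.drep (c⁻¹ • Y) = gen 0 v := by
    rw [map_smul, hw, smul_gen, smul_zero, smul_smul, inv_mul_cancel₀ hc.ne', one_smul]
  refine ⟨v, c⁻¹ • Y, hv, hX, le_antisymm ?_ ?_⟩
  · exact (M.isMaximalAbelianIn_span hv hX).2 ha.1 (by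
      rw [Submodule.span_le, Set.singleton_subset_iff]; exact a.smul_mem _ hY)
  · rw [Submodule.span_le, Set.singleton_subset_iff]; exact a.smul_mem _ hY

theorem exists_isPlanarTriple (M : LorentzModel G₀ n) (hn : 2 ≤ n) :
    ∃ a : Fin 3 → Submodule ℝ (lieAlg G₀), IsPlanarTriple G₀ a := by
  let e : Fin n → ℝ := Pi.single ⟨0, by omega⟩ 1
  let f : Fin n → ℝ := Pi.single ⟨1, by omega⟩ 1
  have he : e ⬝ᵥ e = 1 := by simp [e]
  have hf : f ⬝ᵥ f = 1 := by simp [f]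
  have hef : e ⬝ᵥ f = 0 := by simp [e, f]
  have hfe : f ⬝ᵥ e = 0 := by simp [e, f]
  obtain ⟨X, hX⟩ := M.surj 0 e (by simp)
  obtain ⟨Y, hY⟩ := M.surj 0 f (by simp)
  have hli : ∀ c d : ℝ, c • X + d • Y = 0 → c = 0 ∧ d = 0 := by
    intro c d h
    have h1 := congrArg M.drep h
    rw [map_add, map_smul, map_smul, hX, hY, smul_gen, smul_gen, gen_add, map_zero, ← gen_zero,
      gen_inj] at h1
    have h2 := congrArg (fun u => e ⬝ᵥ u) h1.2
    have h3 := congrArg (fun u => f ⬝ᵥ u) h1.2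
    simp only [dotProduct_add, dotProduct_smul, he, hef, hfe, hf, smul_eq_mul, dotProduct_zero]
      at h2 h3
    constructor <;> linarith
  -- The triple 3, 4, 5 gives a unit vector that is parallel to neither `e` nor `f`.
  let Z : lieAlg G₀ := (3 / 5 : ℝ) • X + (4 / 5 : ℝ) • Y
  have hZ : M.drep Z = gen 0 ((3 / 5 : ℝ) • e + (4 / 5 : ℝ) • f) := by
    rw [map_add, map_smul, map_smul, hX, hY, smul_gen, smul_gen, gen_add, smul_zero, smul_zero,
      add_zero]
  let T : Fin 3 → lieAlg G₀ := ![X, Y, Z]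
  refine ⟨fun j => Submodule.span ℝ {T j}, ?_, ?_, ?_⟩
  · intro j
    fin_cases j
    · exact M.isMaximalAbelianIn_span he hX
    · exact M.isMaximalAbelianIn_span hf hY
    · refine M.isMaximalAbelianIn_span ?_ hZ
      simp only [add_dotProduct, dotProduct_add, smul_dotProduct, dotProduct_smul, he, hf, hef, hfe,
        smul_eq_mul]
      norm_num
  · have key : ∀ j k : Fin 3, Submodule.span ℝ {T j} = Submodule.span ℝ {T k} →
        ∃ c : ℝ, c • T k = T j := fun j k h =>
      Submodule.mem_span_singleton.1 (h ▸ Submodule.mem_span_singleton_self _)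
    have h10 : ¬ ∃ c : ℝ, c • X = Y := by
      rintro ⟨c, hc⟩
      have := hli c (-1) (by rw [hc]; module)
      norm_num at this
    have h20 : ¬ ∃ c : ℝ, c • X = Z := by
      rintro ⟨c, hc⟩
      have := hli (c - 3 / 5) (-(4 / 5)) (by rw [sub_smul, hc]; simp only [Z]; module)
      norm_num at this
    have h21 : ¬ ∃ c : ℝ, c • Y = Z := by
      rintro ⟨c, hc⟩
      have := hli (-(3 / 5)) (c - 4 / 5) (by rw [sub_smul, hc]; simp only [Z]; module)
      norm_num at this
    intro j k hjk
    fin_cases j <;> fin_cases k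
    · rfl
    · exact absurd (key 1 0 hjk.symm) h10
    · exact absurd (key 2 0 hjk.symm) h20
    · exact absurd (key 1 0 hjk) h10
    · rfl
    · exact absurd (key 2 1 hjk.symm) h21
    · exact absurd (key 2 0 hjk) h20
    · exact absurd (key 2 1 hjk) h21
    · rfl
  · have hsup : (⨆ j, Submodule.span ℝ {T j}) = Submodule.span ℝ (Set.range ![X, Y]) := by
      rw [← Submodule.span_iUnion]
      apply le_antisymm
      · rw [Submodule.span_le]
        intro U hU
        obtain ⟨j, hj⟩ := Set.mem_iUnion.1 hU
        rw [Set.mem_singleton_iff] at hj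
        have hX' : X ∈ Submodule.span ℝ (Set.range ![X, Y]) :=
          Submodule.subset_span ⟨0, rfl⟩
        have hY' : Y ∈ Submodule.span ℝ (Set.range ![X, Y]) :=
          Submodule.subset_span ⟨1, rfl⟩
        subst hj
        fin_cases j
        · exact hX'
        · exact hY'
        · exact Submodule.add_mem _ (Submodule.smul_mem _ _ hX') (Submodule.smul_mem _ _ hY')
      · rw [Submodule.span_le]
        rintro _ ⟨j, rfl⟩
        apply Submodule.subset_span
        rw [Set.mem_iUnion]
        fin_cases j
        · exact ⟨0, rfl⟩
        · exact ⟨1, rfl⟩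
    rw [hsup, finrank_span_eq_card (LinearIndependent.pair_iff.2 hli), Fintype.card_fin]

/-- The directions of a planar triple in an orthonormal basis `e, f` of its plane. -/
theorem exists_frame_of_isPlanarTriple (hn : 2 ≤ n) {a : Fin 3 → Submodule ℝ (lieAlg G₀)}
    (ha : IsPlanarTriple G₀ a) :
    ∃ (e f : Fin n → ℝ) (X Y Z : lieAlg G₀) (c c' d d' : ℝ), e ⬝ᵥ e = 1 ∧ f ⬝ᵥ f = 1 ∧
      e ⬝ᵥ f = 0 ∧ d ≠ 0 ∧ d' ≠ 0 ∧ c ^ 2 + d ^ 2 = 1 ∧ c' ^ 2 + d' ^ 2 = 1 ∧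
      X ∈ a 0 ∧ Y ∈ a 1 ∧ Z ∈ a 2 ∧ M.drep X = gen 0 e ∧ M.drep Y = gen 0 (c • e + d • f) ∧
      M.drep Z = gen 0 (c' • e + d' • f) := by
  obtain ⟨e, X, he, hX, haX⟩ := M.exists_of_isMaximalAbelianIn hn (ha.1 0)
  obtain ⟨v, Y, hv, hY, haY⟩ := M.exists_of_isMaximalAbelianIn hn (ha.1 1)
  obtain ⟨w, Z, hw, hZ, haZ⟩ := M.exists_of_isMaximalAbelianIn hn (ha.1 2)
  have hne : ∀ (V U : lieAlg G₀) (r : ℝ) (i j : Fin 3), i ≠ j → U ≠ 0 →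
      a i = Submodule.span ℝ {V} → a j = Submodule.span ℝ {U} → U ≠ r • V := by
    intro V U r i j hij hU hi hj hUV
    apply hij
    apply ha.2.1
    rw [hi, hj, hUV, Submodule.span_singleton_smul_eq]
    refine (isUnit_iff_ne_zero.2 ?_)
    rintro rfl
    exact hU (by rw [hUV, zero_smul])
  have hunit : ∀ (u : Fin n → ℝ) (U : lieAlg G₀), u ⬝ᵥ u = 1 → M.drep U = gen 0 u → U ≠ 0 := by
    rintro u U hu hU rfl
    rw [map_zero, ← gen_zero, gen_inj] at hU
    rw [← hU.2] at hu
    simp at hu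
  have hvr : ∀ r : ℝ, v ≠ r • e := by
    rintro r rfl
    refine hne X Y r 0 1 (by decide) (hunit _ _ hv hY) haX haY (M.inj ?_)
    rw [hY, map_smul, hX, smul_gen, smul_zero]
  have hwr : ∀ r : ℝ, w ≠ r • e := by
    rintro r rfl
    refine hne X Z r 0 2 (by decide) (hunit _ _ hw hZ) haX haZ (M.inj ?_)
    rw [hZ, map_smul, hX, smul_gen, smul_zero]
  -- Gram–Schmidt: `f` is the normalized part of `v` orthogonal to `e`, nonzero because the first
  -- two lines differ.
  obtain ⟨d, hd, f, hf, hvf⟩ := exists_normalize (v := v - (e ⬝ᵥ v) • e)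
    (fun h => hvr _ (sub_eq_zero.1 h))
  have hef : e ⬝ᵥ f = 0 := by
    have h : e ⬝ᵥ (d • f) = 0 := by
      rw [← hvf, dotProduct_sub, dotProduct_smul, he, smul_eq_mul, mul_one, sub_self]
    rw [dotProduct_smul, smul_eq_mul] at h
    exact (mul_eq_zero.1 h).resolve_left hd.ne'
  have hfe : f ⬝ᵥ e = 0 := by rw [dotProduct_comm, hef]
  have hv' : v = (e ⬝ᵥ v) • e + d • f := by rw [← hvf]; module
  have hnorm : ∀ x y : ℝ, (x • e + y • f) ⬝ᵥ (x • e + y • f) = x ^ 2 + y ^ 2 := by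
    intro x y
    simp only [add_dotProduct, dotProduct_add, smul_dotProduct, dotProduct_smul, he, hf, hef, hfe,
      smul_eq_mul]
    ring
  -- `X` and `Y` already span a plane, which must be the whole two-dimensional sum.
  obtain ⟨r, s, hrs⟩ : ∃ r s : ℝ, Z = r • X + s • Y := by
    have hli : LinearIndependent ℝ ![X, Y] := by
      rw [LinearIndependent.pair_iff' (hunit _ _ he hX)]
      exact fun r => (hne X Y r 0 1 (by decide) (hunit _ _ hv hY) haX haY).symm
    have hle : Submodule.span ℝ (Set.range ![X, Y]) ≤ ⨆ j, a j := by
      rw [Submodule.span_le]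
      rintro _ ⟨j, rfl⟩
      fin_cases j
      · exact Submodule.mem_iSup_of_mem 0 (haX ▸ Submodule.mem_span_singleton_self X)
      · exact Submodule.mem_iSup_of_mem 1 (haY ▸ Submodule.mem_span_singleton_self Y)
    have hfin : FiniteDimensional ℝ (⨆ j, a j : Submodule ℝ (lieAlg G₀)) :=
      FiniteDimensional.of_finrank_pos (by rw [ha.2.2]; norm_num)
    have heq := Submodule.eq_of_le_of_finrank_eq hle (by
      rw [ha.2.2, finrank_span_eq_card hli, Fintype.card_fin])
    have hmem : Z ∈ Submodule.span ℝ (Set.range ![X, Y]) := by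
      rw [heq]
      exact Submodule.mem_iSup_of_mem 2 (haZ ▸ Submodule.mem_span_singleton_self Z)
    rw [Matrix.range_cons_cons_empty, Submodule.mem_span_pair] at hmem
    obtain ⟨r, s, h⟩ := hmem
    exact ⟨r, s, h.symm⟩
  have hw' : w = (r + s * (e ⬝ᵥ v)) • e + (s * d) • f := by
    have h := congrArg M.drep hrs
    rw [hZ, map_add, map_smul, map_smul, hX, hY, smul_gen, smul_gen, gen_add, gen_inj] at h
    rw [h.2, hv']
    simp only [dotProduct_add, dotProduct_smul, he, hef, smul_eq_mul]
    module
  refine ⟨e, f, X, Y, Z, e ⬝ᵥ v, r + s * (e ⬝ᵥ v), d, s * d, he, hf, hef, hd.ne', ?_, ?_, ?_,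
    haX ▸ Submodule.mem_span_singleton_self X, haY ▸ Submodule.mem_span_singleton_self Y,
    haZ ▸ Submodule.mem_span_singleton_self Z, hX, hv' ▸ hY, hw' ▸ hZ⟩
  · intro h
    rw [h, zero_smul, add_zero] at hw'
    exact hwr _ hw'
  · rw [← hnorm, ← hv', hv]
  · rw [← hnorm, ← hw', hw]

end LorentzModel

/-! ### The Lorentz form, null vectors and eigenvectors of boosts. -/

section LorentzForm

variable {n : ℕ}

/-- The Lorentz form on `ℝⁿ ⊕ ℝ`. -/
def lor (x y : Fin n ⊕ Fin 1 → ℝ) : ℝ :=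
  (x ∘ Sum.inl) ⬝ᵥ (y ∘ Sum.inl) - x (Sum.inr 0) * y (Sum.inr 0)

theorem lor_comm (x y : Fin n ⊕ Fin 1 → ℝ) : lor x y = lor y x := by
  rw [lor, lor, dotProduct_comm, mul_comm]

theorem lor_vec (ξ η : Fin n → ℝ) (s t : ℝ) : lor (vec ξ s) (vec η t) = ξ ⬝ᵥ η - s * t := rfl

theorem lor_add (x y z : Fin n ⊕ Fin 1 → ℝ) : lor x (y + z) = lor x y + lor x z := by
  obtain ⟨ξ, r, rfl⟩ := vec_surj x
  obtain ⟨η, s, rfl⟩ := vec_surj y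
  obtain ⟨ζ, t, rfl⟩ := vec_surj z
  rw [vec_add, lor_vec, lor_vec, lor_vec, dotProduct_add]
  ring

theorem lor_smul (c : ℝ) (x y : Fin n ⊕ Fin 1 → ℝ) : lor x (c • y) = c * lor x y := by
  obtain ⟨ξ, r, rfl⟩ := vec_surj x
  obtain ⟨η, s, rfl⟩ := vec_surj y
  rw [smul_vec, lor_vec, lor_vec, dotProduct_smul, smul_eq_mul]
  ring

theorem lor_sub (x y z : Fin n ⊕ Fin 1 → ℝ) : lor x (y - z) = lor x y - lor x z := by
  rw [sub_eq_add_neg, ← neg_one_smul ℝ z, lor_add, lor_smul]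
  ring

theorem lor_gen_mulVec {R : Matrix (Fin n) (Fin n) ℝ} (hR : Rᵀ = -R) (v : Fin n → ℝ)
    (x : Fin n ⊕ Fin 1 → ℝ) : lor x (gen R v *ᵥ x) = 0 := by
  obtain ⟨ξ, r, rfl⟩ := vec_surj x
  have h := dotProduct_mulVec_of_skew hR ξ ξ
  rw [dotProduct_comm (R *ᵥ ξ)] at h
  rw [gen_mulVec, lor_vec, dotProduct_add, dotProduct_smul, smul_eq_mul, dotProduct_comm v]
  linarith

/-- The transformation `x ↦ ⟨a, x⟩ b - ⟨b, x⟩ a` belongs to `𝔰𝔬(n,1)`. -/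
theorem exists_gen_eq_wedge (a b : Fin n ⊕ Fin 1 → ℝ) :
    ∃ R v, Rᵀ = -R ∧ ∀ x, gen R v *ᵥ x = lor a x • b - lor b x • a := by
  obtain ⟨p, α, rfl⟩ := vec_surj a
  obtain ⟨q, β, rfl⟩ := vec_surj b
  refine ⟨wedge q p, β • p - α • q, wedge_transpose q p, fun x => ?_⟩
  obtain ⟨ξ, t, rfl⟩ := vec_surj x
  rw [gen_mulVec, lor_vec, lor_vec, smul_vec, smul_vec, vec_sub, vec_inj, wedge_mulVec,
    sub_dotProduct, smul_dotProduct, smul_dotProduct, smul_eq_mul, smul_eq_mul]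
  exact ⟨by module, by ring⟩

/-- Given three null vectors, an infinitesimal Lorentz transformation which fixes the lines of the
last two can move the line of the first in any direction. -/
theorem exists_gen_of_null {x y z τ : Fin n ⊕ Fin 1 → ℝ} (hx : lor x x = 0) (hy : lor y y = 0)
    (hz : lor z z = 0) (hxy : lor x y ≠ 0) (hxz : lor x z ≠ 0) (hyz : lor y z ≠ 0)
    (hτ : lor x τ = 0) :
    ∃ R v, Rᵀ = -R ∧ (∃ c : ℝ, gen R v *ᵥ x - τ = c • x) ∧ (∃ c : ℝ, gen R v *ᵥ y = c • y) ∧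
      ∃ c : ℝ, gen R v *ᵥ z = c • z := by
  have hyx := lor_comm y x
  have hzx := lor_comm z x
  have hzy := lor_comm z y
  set b := lor x y with hb
  set b' := lor x z with hb'
  set b'' := lor y z with hb''
  set p := lor y τ with hp
  set q := lor z τ with hq
  -- The vector `c` in the span of `x, y, z` is orthogonal to `y` and `z`. The coefficients `t` and
  -- `κ` are solved from the requirement that `τ'`, which is `τ` minus a combination of `x` and `b z
  -- - b' y`, be orthogonal to `x, y, z`. The wedge of `c` and `τ'` then kills `y` and `z` and sends
  -- `x` to a multiple of `τ'`, while the wedge of `y` and `z` scales `y` and `z` and sends `x` to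
  -- `b z - b' y`. A suitable combination of the two sends `x` to `τ - t x`.
  let κ : ℝ := (p / b - q / b') / (2 * b'')
  let t : ℝ := (p / b + q / b') / 2
  let c : Fin n ⊕ Fin 1 → ℝ := (-b'') • x + b' • y + b • z
  let τ' : Fin n ⊕ Fin 1 → ℝ := τ - (t • x + (-(κ * b')) • y + (κ * b) • z)
  have hκ : 2 * b'' * κ = p / b - q / b' := by simp only [κ]; field_simp
  have h1 : b * (t + κ * b'') = p := by
    have : t + κ * b'' = p / b := by simp only [t]; linarith
    rw [this]; field_simp
  have h2 : b' * (t - κ * b'') = q := by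
    have : t - κ * b'' = q / b' := by simp only [t]; linarith
    rw [this]; field_simp
  have hcx : lor x c = 2 * b * b' := by
    simp only [c, lor_add, lor_smul, hx, ← hb, ← hb']; ring
  have hcy : lor y c = 0 := by
    simp only [c, lor_add, lor_smul, hy, hyx, ← hb'']; ring
  have hcz : lor z c = 0 := by
    simp only [c, lor_add, lor_smul, hz, hzx, hzy]; ring
  have hx' : lor x τ' = 0 := by
    simp only [τ', lor_sub, lor_add, lor_smul, hx, ← hb, ← hb', hτ]; ring
  have hy' : lor y τ' = 0 := by
    simp only [τ', lor_sub, lor_add, lor_smul, hy, hyx, ← hb'', ← hp]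
    linarith
  have hz' : lor z τ' = 0 := by
    simp only [τ', lor_sub, lor_add, lor_smul, hz, hzx, hzy, ← hq]
    linarith
  obtain ⟨R, v, hR, h⟩ := exists_gen_eq_wedge c τ'
  obtain ⟨S, w, hS, h'⟩ := exists_gen_eq_wedge y z
  have hgen : ∀ u, gen ((2 * b * b')⁻¹ • R + κ • S) ((2 * b * b')⁻¹ • v + κ • w) *ᵥ u =
      (2 * b * b')⁻¹ • (lor u c • τ' - lor u τ' • c) + κ • (lor u y • z - lor u z • y) := by
    intro u
    rw [← gen_add, ← smul_gen, ← smul_gen, add_mulVec, smul_mulVec, smul_mulVec, h, h',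
      lor_comm c, lor_comm τ', lor_comm y, lor_comm z]
  refine ⟨(2 * b * b')⁻¹ • R + κ • S, (2 * b * b')⁻¹ • v + κ • w, ?_, ⟨-t, ?_⟩, ⟨-(κ * b''), ?_⟩,
    ⟨κ * b'', ?_⟩⟩
  · rw [transpose_add, transpose_smul, transpose_smul, hR, hS]; module
  · have h0 : (2 * b * b') ≠ 0 := by positivity
    rw [hgen, hcx, hx', ← hb, ← hb', zero_smul, sub_zero, smul_smul, inv_mul_cancel₀ h0]
    simp only [τ']
    module
  · rw [hgen, hcy, hy', hy, ← hb'']; module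
  · rw [hgen, hcz, hz', hz, hzy]; module

/-- A boost by a unit vector has eigenvalues `1, 0, -1`; the top one is simple, with eigenvector
`(w, 1)`, and nothing lies above it. -/
theorem boost_eigenvector {w ξ : Fin n → ℝ} {t c : ℝ} (hw : w ⬝ᵥ w = 1)
    (h : gen 0 w *ᵥ vec ξ t = c • vec ξ t) (hc : 1 ≤ c) :
    vec ξ t = t • vec w 1 ∧ (c = 1 ∨ t = 0) := by
  rw [gen_mulVec, smul_vec, vec_inj, zero_mulVec, zero_add] at h
  have h1 : t = c * (w ⬝ᵥ ξ) := by
    have := congrArg (fun u => w ⬝ᵥ u) h.1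
    simpa [dotProduct_smul, hw] using this
  have h2 : (c ^ 2 - 1) * t = 0 := by
    have := h.2
    linear_combination (-c) * this - h1
  have h3 : t = 0 ∨ c = 1 := by
    rcases mul_eq_zero.1 h2 with h3 | h3
    · right; nlinarith
    · left; exact h3
  rw [smul_vec, vec_inj, mul_one]
  rcases h3 with rfl | rfl
  · have : c • ξ = 0 := by rw [← h.1, zero_smul]
    have hξ : ξ = 0 := (smul_eq_zero.1 this).resolve_left (by linarith)
    exact ⟨⟨by rw [hξ, zero_smul], rfl⟩, Or.inr rfl⟩
  · exact ⟨⟨by rw [h.1, one_smul], rfl⟩, Or.inl rfl⟩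

end LorentzForm

/-! ### Minimal parabolic subalgebras as stabilizers of null lines; the spherical decomposition. -/

namespace LorentzModel

variable {𝕜 : Type} [RCLike 𝕜] {ι : Type} [Fintype ι] [DecidableEq ι]
  {G₀ : Subgroup (SpecialLinearGroup ι 𝕜)} {n : ℕ} (M : LorentzModel G₀ n)

/-- These are the root vectors of the positive root; they annihilate the null vector `(w, 1)`. -/
theorem lie_nilpotent {w u : Fin n → ℝ} {X N : lieAlg G₀} (hw : w ⬝ᵥ w = 1) (hu : u ⬝ᵥ w = 0)
    (hX : M.drep X = gen 0 w) (hN : M.drep N = gen (wedge w u) u) : ⁅X, N⁆ = N := by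
  apply M.inj
  rw [LieHom.map_lie, hX, hN, lie_gen (by simp) (wedge_transpose w u), gen_inj]
  refine ⟨?_, ?_⟩
  · simp [Ring.lie_def]
  · rw [wedge_mulVec, hw, hu]; simp

/-- Since `X` fixes `(w, 1)`, the bracket relation makes `Y (w, 1)` an eigenvector of `X` with
eigenvalue `1 + c ≥ 1`, so it lies on the line of `(w, 1)`. -/
theorem mulVec_eigenvector {w : Fin n → ℝ} {X Y : lieAlg G₀} {c : ℝ} (hw : w ⬝ᵥ w = 1)
    (hX : M.drep X = gen 0 w) (hc : 0 ≤ c) (h : ⁅X, Y⁆ = c • Y) :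
    ∃ d : ℝ, M.drep Y *ᵥ vec w 1 = d • vec w 1 := by
  have h1 := congrArg (fun Z => M.drep Z *ᵥ vec w 1) h
  have h2 : gen 0 w *ᵥ vec w 1 = vec w 1 := by
    rw [gen_mulVec, hw]; simp
  simp only [LieHom.map_lie, hX, map_smul, Ring.lie_def, sub_mulVec, ← mulVec_mulVec, h2,
    smul_mulVec] at h1
  obtain ⟨ξ, t, hξ⟩ := vec_surj (M.drep Y *ᵥ vec w 1)
  rw [hξ] at h1 ⊢
  refine ⟨t, (boost_eigenvector hw (c := 1 + c) ?_ (by linarith)).1⟩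
  rw [add_smul, one_smul, ← h1]
  abel

/-- The coefficient of `X` in `c • X + ⋯`, where `X` is the boost in direction `w`. -/
def coeff (w : Fin n → ℝ) : lieAlg G₀ →ₗ[ℝ] ℝ where
  toFun Y := vec w 0 ⬝ᵥ (M.drep Y *ᵥ vec 0 1)
  map_add' Y Z := by rw [map_add, add_mulVec, dotProduct_add]
  map_smul' c Y := by rw [map_smul, smul_mulVec, dotProduct_smul]; rfl

theorem coeff_smul {w : Fin n → ℝ} {X : lieAlg G₀} (hw : w ⬝ᵥ w = 1)
    (hX : M.drep X = gen 0 w) (c : ℝ) : M.coeff w (c • X) = c := by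
  have : M.coeff w X = 1 := by
    change vec w 0 ⬝ᵥ (M.drep X *ᵥ vec 0 1) = 1
    rw [hX, gen_mulVec]
    have h : vec w 0 ⬝ᵥ vec w 0 = w ⬝ᵥ w := by simp [vec]
    simpa [h] using hw
  rw [map_smul, this, smul_eq_mul, mul_one]

/-- An element of `𝔤₀` which fixes the null line through `(w, 1)` is the sum of an element of
`𝔨₀` that commutes with the boost `X` in direction `w`, a multiple of `X`, and an element `N` with
`[X, N] = N`. -/
theorem exists_decomposition {w : Fin n → ℝ} {X Y : lieAlg G₀} {d : ℝ} (hw : w ⬝ᵥ w = 1)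
    (hX : M.drep X = gen 0 w) (h : M.drep Y *ᵥ vec w 1 = d • vec w 1) :
    ∃ (U N : lieAlg G₀) (c : ℝ), U ∈ k₀ G₀ ∧ ⁅X, U⁆ = 0 ∧ ⁅X, N⁆ = N ∧ Y = U + c • X + N := by
  obtain ⟨R, v, hR, hY⟩ := M.exists_eq_gen Y
  rw [hY, gen_mulVec, smul_vec, vec_inj, one_smul, mul_one] at h
  -- The boost part of `Y` splits into `d • w`, carried by `X`, and `u`, carried by `N`. What
  -- remains is a pure rotation, and it fixes `w` because `R *ᵥ w = -u`.
  let u : Fin n → ℝ := v - d • w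
  have hRw : R *ᵥ w = -u := by
    rw [← sub_eq_zero]; simp only [u]; rw [sub_neg_eq_add, ← add_sub_assoc, h.1, sub_self]
  have hu : u ⬝ᵥ w = 0 := by
    rw [sub_dotProduct, smul_dotProduct, hw, h.2, smul_eq_mul, mul_one, sub_self]
  obtain ⟨N, hN⟩ := M.surj (wedge w u) u (wedge_transpose w u)
  have hS : (R - wedge w u)ᵀ = -(R - wedge w u) := by
    rw [transpose_sub, hR, wedge_transpose]; abel
  obtain ⟨U, hU⟩ := M.surj (R - wedge w u) 0 hS
  refine ⟨U, N, d, (M.mem_k₀ U).2 ⟨_, hU⟩, ?_, M.lie_nilpotent hw hu hX hN, ?_⟩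
  · apply M.inj
    rw [LieHom.map_lie, hX, hU, lie_gen (by simp) hS, map_zero, ← gen_zero, gen_inj, sub_mulVec,
      wedge_mulVec, hw, hu, hRw]
    refine ⟨?_, ?_⟩
    · simp [Ring.lie_def, wedge]
    · simp
  · apply M.inj
    rw [map_add, map_add, map_smul, hX, hU, hN, hY, smul_gen, gen_add, gen_add, gen_inj]
    refine ⟨by simp, ?_⟩
    simp only [u]
    abel

/-- A minimal parabolic subalgebra of `𝔤` is the stabilizer of a triple of null lines. -/
theorem exists_mem_iff_of_isMinimalParabolic (hn : 2 ≤ n)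
    {p : Submodule ℝ (Fin 3 → lieAlg G₀)}
    (hp : IsMinimalParabolic (prod₃ fun _ => k₀ G₀) (prod₃ fun _ => s₀ G₀) p) :
    ∃ w : Fin 3 → Fin n → ℝ, (∀ j, w j ⬝ᵥ w j = 1) ∧
      ∀ Z, Z ∈ p ↔ ∀ j, ∃ d : ℝ, M.drep (Z j) *ᵥ vec (w j) 1 = d • vec (w j) 1 := by
  obtain ⟨a, ha, S, ⟨X₀, hreg, rfl⟩, rfl⟩ := hp
  obtain ⟨b, hb, hab⟩ := ha.exists_eq_prod₃
  have hw : ∀ j, ∃ (w : Fin n → ℝ) (X : lieAlg G₀) (c : ℝ), w ⬝ᵥ w = 1 ∧ M.drep X = gen 0 w ∧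
      b j = Submodule.span ℝ {X} ∧ X₀.1 j = c • X ∧ 0 ≤ c := by
    intro j
    obtain ⟨v, X, hv, hX, hbX⟩ := M.exists_of_isMaximalAbelianIn hn (hb j)
    have hX₀ : X₀.1 j ∈ b j := mem_prod₃.1 (hab ▸ X₀.2) j
    rw [hbX] at hX₀
    obtain ⟨c, hc⟩ := Submodule.mem_span_singleton.1 hX₀
    -- The unit direction of each line is determined up to sign; the sign is chosen so that `X₀` has
    -- a nonnegative coefficient.
    rcases le_total 0 c with h | h
    · exact ⟨v, X, c, hv, hX, hbX, hc.symm, h⟩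
    · refine ⟨-v, -X, -c, by simpa using hv, ?_, ?_, by simpa using hc.symm, by linarith⟩
      · rw [← neg_one_smul ℝ X, map_smul, hX, smul_gen, smul_zero, neg_one_smul]
      · rw [hbX, ← neg_one_smul ℝ X, Submodule.span_singleton_smul_eq (by simp)]
  choose w X c hw hX hbX hX₀ hc using hw
  have hmem : ∀ j, X j ∈ b j := fun j => hbX j ▸ Submodule.mem_span_singleton_self _
  have hXa : ∀ j, (Pi.single j (X j) : Fin 3 → lieAlg G₀) ∈ a := fun j =>
    hab ▸ single_mem_prod₃ (hmem j)
  let α : Fin 3 → Module.Dual ℝ a := fun j =>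
    (M.coeff (w j)).comp ((LinearMap.proj j).comp a.subtype)
  have hα : ∀ j (U : a), U.1 j = α j U • X j := by
    intro j U
    have hU : U.1 j ∈ b j := mem_prod₃.1 (hab ▸ U.2) j
    rw [hbX] at hU
    obtain ⟨r, hr⟩ := Submodule.mem_span_singleton.1 hU
    have : α j U = r := by
      change M.coeff (w j) (U.1 j) = r
      rw [← hr, M.coeff_smul (hw j) (hX j)]
    rw [this, hr]
  have hαX₀ : ∀ j, α j X₀ = c j := by
    intro j
    change M.coeff (w j) (X₀.1 j) = c j
    rw [hX₀, M.coeff_smul (hw j) (hX j)]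
  have hspace : ∀ j N, ⁅X j, N⁆ = N →
      (Pi.single j N : Fin 3 → lieAlg G₀) ∈ rootSpace a (α j) := by
    intro j N hN U
    rw [lie_single, hα j U, smul_lie, hN, Pi.single_smul]
  have hroot : ∀ j, IsRoot a (α j) := by
    intro j
    constructor
    · intro h0
      have h1 : α j ⟨_, hXa j⟩ = 1 := by
        change M.coeff (w j) ((Pi.single j (X j) : Fin 3 → lieAlg G₀) j) = 1
        rw [Pi.single_eq_same, ← one_smul ℝ (X j), M.coeff_smul (hw j) (hX j)]
      rw [h0] at h1
      exact zero_ne_one h1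
    · obtain ⟨u, hu, huw⟩ := exists_orthogonal hn (w j)
      obtain ⟨N, hN⟩ := M.surj (wedge (w j) u) u (wedge_transpose _ _)
      intro h0
      have h1 := hspace j N (M.lie_nilpotent (hw j) huw (hX j) hN)
      rw [h0, Submodule.mem_bot, Pi.single_eq_zero_iff] at h1
      rw [h1, map_zero, ← gen_zero, gen_inj] at hN
      exact hu hN.2.symm
  -- `X₀` is regular, so the root `α j` does not vanish on it.
  have hcpos : ∀ j, 0 < c j := fun j =>
    lt_of_le_of_ne (hc j) fun h => hreg (α j) (hroot j) (by rw [hαX₀, h])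
  refine ⟨w, hw, fun Z => ⟨fun hZ j => ?_, fun hZ => ?_⟩⟩
  · let stab : Submodule ℝ (Fin 3 → lieAlg G₀) :=
      { carrier := {Z | ∃ d : ℝ, M.drep (Z j) *ᵥ vec (w j) 1 = d • vec (w j) 1}
        zero_mem' := ⟨0, by simp⟩
        add_mem' := by
          rintro U V ⟨d, hd⟩ ⟨d', hd'⟩
          exact ⟨d + d', by rw [Pi.add_apply, map_add, add_mulVec, hd, hd', add_smul]⟩
        smul_mem' := by
          rintro r U ⟨d, hd⟩
          exact ⟨r * d, by rw [Pi.smul_apply, map_smul, smul_mulVec, hd, smul_smul]⟩ }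
    suffices hle : centralizerIn (prod₃ fun _ => k₀ G₀) a ⊔ a ⊔
        ⨆ α ∈ {α | IsRoot a α ∧ 0 < α X₀}, rootSpace a α ≤ stab from hle hZ
    refine sup_le (sup_le ?_ ?_) (iSup₂_le ?_)
    · intro Y hY
      have h := congrFun (hY.2 _ (hXa j)) j
      rw [lie_apply, Pi.single_eq_same] at h
      exact M.mulVec_eigenvector (hw j) (hX j) le_rfl (by rw [h, zero_smul]; rfl)
    · intro Y hY
      refine M.mulVec_eigenvector (hw j) (hX j) le_rfl ?_
      rw [show Y j = _ from hα j ⟨Y, hY⟩, lie_smul, lie_self, smul_zero, zero_smul]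
    -- Roots need not be classified: bracketing with `X₀` alone shows that the `j`-th component is
    -- an eigenvector of `X j` with eigenvalue `β X₀ / c j ≥ 0`.
    · rintro β ⟨-, hβ⟩ Y hY
      have h := congrFun (hY X₀) j
      rw [lie_apply, hX₀, smul_lie, Pi.smul_apply] at h
      refine M.mulVec_eigenvector (hw j) (hX j) (div_nonneg hβ.le (hc j)) (c := β X₀ / c j) ?_
      rw [div_eq_inv_mul, mul_smul, ← h, smul_smul, inv_mul_cancel₀ (hcpos j).ne', one_smul]
  · choose d hd using hZ
    have hdec := fun j => M.exists_decomposition (hw j) (hX j) (hd j)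
    choose U N r hU hUX hN hZ using hdec
    have hsum : Z = U + (fun j => r j • X j) + ∑ j, Pi.single j (N j) := by
      rw [Finset.univ_sum_single]
      funext j
      exact hZ j
    rw [hsum]
    refine Submodule.add_mem_sup (Submodule.add_mem_sup ⟨mem_prod₃.2 hU, ?_⟩ ?_)
      (Submodule.sum_mem _ fun j _ => ?_)
    · intro V hV
      funext j
      rw [lie_apply, show V j = _ from hα j ⟨V, hV⟩, smul_lie, hUX, smul_zero]
      rfl
    · rw [hab]
      exact mem_prod₃.2 fun j => Submodule.smul_mem _ _ (hmem j)
    · exact Submodule.mem_iSup_of_mem (α j) (Submodule.mem_iSup_of_mem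
        ⟨hroot j, by rw [hαX₀]; exact hcpos j⟩ (hspace j (N j) (hN j)))

theorem sphericalDecomposition_of_isPlanarTriple (M : LorentzModel G₀ n) (hn : 2 ≤ n)
    {a : Fin 3 → Submodule ℝ (lieAlg G₀)} (ha : IsPlanarTriple G₀ a)
    {p : Submodule ℝ (Fin 3 → lieAlg G₀)}
    (hp : IsMinimalParabolic (prod₃ fun _ => k₀ G₀) (prod₃ fun _ => s₀ G₀) p)
    (hap : prod₃ a ≤ p) : SphericalDecomposition G₀ p := by
  obtain ⟨w, hw, hmem⟩ := M.exists_mem_iff_of_isMinimalParabolic hn hp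
  -- The boost spanning `a j` stabilizes the null line of `(w j, 1)`, which forces its unit
  -- direction to be `w j` or `-w j`.
  have hspan : ∀ j, ∃ X : lieAlg G₀, M.drep X = gen 0 (w j) ∧ a j = Submodule.span ℝ {X} := by
    intro j
    obtain ⟨v, X, hv, hX, haX⟩ := M.exists_of_isMaximalAbelianIn hn (ha.1 j)
    have h1 : (Pi.single j X : Fin 3 → lieAlg G₀) ∈ p :=
      hap (single_mem_prod₃ (haX ▸ Submodule.mem_span_singleton_self X))
    obtain ⟨d, hd⟩ := (hmem _).1 h1 j
    rw [Pi.single_eq_same, hX, gen_mulVec, smul_vec, vec_inj, zero_mulVec, zero_add, one_smul] at hd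
    have hdd : d * d = 1 := by
      have h2 := hv
      rw [hd.1, smul_dotProduct, dotProduct_smul, hw] at h2
      simpa using h2
    refine ⟨d • X, by rw [map_smul, hX, smul_gen, smul_zero, hd.1, smul_smul, hdd, one_smul], ?_⟩
    rw [haX, Submodule.span_singleton_smul_eq (IsUnit.of_mul_eq_one d hdd)]
  -- The form is `w j ⬝ᵥ w k - 1`, which vanishes only for equal unit vectors, hence only if `a j =
  -- a k`.
  have hne : ∀ j k, j ≠ k → lor (vec (w j) 1) (vec (w k) 1) ≠ 0 := by
    intro j k hjk h
    apply hjk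
    apply ha.2.1
    rw [lor_vec, mul_one, sub_eq_zero] at h
    have hjk' := eq_of_dotProduct_eq_one (hw j) (hw k) h
    obtain ⟨X, hX, haX⟩ := hspan j
    obtain ⟨Y, hY, haY⟩ := hspan k
    rw [haX, haY, M.inj (hX.trans ((by rw [hjk'] : gen 0 (w j) = gen 0 (w k)).trans hY.symm))]
  have hnull : ∀ j, lor (vec (w j) 1) (vec (w j) 1) = 0 := by
    intro j
    rw [lor_vec, hw, mul_one, sub_self]
  -- `Z` moves the `j`-th null line to first order as `Y` does and stabilizes the other two. Summing
  -- three such elements gives the diagonal component.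
  have hmove : ∀ (j k l : Fin 3) (Y : lieAlg G₀), j ≠ k → j ≠ l → k ≠ l → ∃ Z : lieAlg G₀,
      (∃ d : ℝ, M.drep (Y - Z) *ᵥ vec (w j) 1 = d • vec (w j) 1) ∧
      (∃ d : ℝ, M.drep Z *ᵥ vec (w k) 1 = d • vec (w k) 1) ∧
      ∃ d : ℝ, M.drep Z *ᵥ vec (w l) 1 = d • vec (w l) 1 := by
    intro j k l Y hjk hjl hkl
    obtain ⟨S, u, hS, hY⟩ := M.exists_eq_gen Y
    obtain ⟨R, v, hR, ⟨d, hd⟩, h2, h3⟩ := exists_gen_of_null (hnull j) (hnull k) (hnull l)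
      (hne j k hjk) (hne j l hjl) (hne k l hkl) (lor_gen_mulVec hS u (vec (w j) 1))
    obtain ⟨Z, hZ⟩ := M.surj R v hR
    refine ⟨Z, ⟨-d, ?_⟩, hZ ▸ h2, hZ ▸ h3⟩
    rw [map_sub, sub_mulVec, hZ, hY, neg_smul, ← hd, neg_sub]
  rw [SphericalDecomposition, eq_top_iff]
  rintro Y -
  obtain ⟨Z₀, h00, h01, h02⟩ := hmove 0 1 2 (Y 0) (by decide) (by decide) (by decide)
  obtain ⟨Z₁, h11, h10, h12⟩ := hmove 1 0 2 (Y 1) (by decide) (by decide) (by decide)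
  obtain ⟨Z₂, h22, h20, h21⟩ := hmove 2 0 1 (Y 2) (by decide) (by decide) (by decide)
  have hcomb : ∀ (j : Fin 3) (U V V' : lieAlg G₀),
      (∃ d : ℝ, M.drep U *ᵥ vec (w j) 1 = d • vec (w j) 1) →
      (∃ d : ℝ, M.drep V *ᵥ vec (w j) 1 = d • vec (w j) 1) →
      (∃ d : ℝ, M.drep V' *ᵥ vec (w j) 1 = d • vec (w j) 1) →
      ∃ d : ℝ, M.drep (U - V - V') *ᵥ vec (w j) 1 = d • vec (w j) 1 := by
    rintro j U V V' ⟨d, hd⟩ ⟨d', hd'⟩ ⟨d'', hd''⟩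
    exact ⟨d - d' - d'', by
      rw [map_sub, map_sub, sub_mulVec, sub_mulVec, hd, hd', hd'', sub_smul, sub_smul]⟩
  have hp' : (Y - fun _ => Z₀ + Z₁ + Z₂) ∈ p := by
    rw [hmem]
    have he : ∀ j : Fin 3, (Y - fun _ => Z₀ + Z₁ + Z₂ : Fin 3 → lieAlg G₀) j = Y j - (Z₀ + Z₁ + Z₂) := fun _ => rfl
    intro j
    rw [he]
    match j with
    | 0 =>
      rw [show Y 0 - (Z₀ + Z₁ + Z₂) = Y 0 - Z₀ - Z₁ - Z₂ by abel]
      exact hcomb 0 _ _ _ h00 h10 h20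
    | 1 =>
      rw [show Y 1 - (Z₀ + Z₁ + Z₂) = Y 1 - Z₁ - Z₀ - Z₂ by abel]
      exact hcomb 1 _ _ _ h11 h01 h21
    | 2 =>
      rw [show Y 2 - (Z₀ + Z₁ + Z₂) = Y 2 - Z₂ - Z₀ - Z₁ by abel]
      exact hcomb 2 _ _ _ h22 h02 h12
  have hd : (fun _ => Z₀ + Z₁ + Z₂ : Fin 3 → lieAlg G₀) ∈ diagonal (lieAlg G₀) :=
    ⟨Z₀ + Z₁ + Z₂, by funext j; rfl⟩
  have := Submodule.add_mem_sup hp' hd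
  rwa [sub_add_cancel] at this

end LorentzModel

/-! ### Three points and three geodesics in hyperbolic space; the polar decomposition. -/

/-- The length of the translation along a geodesic that brings a point of the hyperbolic plane,
with coordinates `x` and `y` along and across the geodesic, to a line of slope `1 / m`. -/
noncomputable def boostLength (m x y : ℝ) : ℝ :=
  Real.arsinh (m * y / √(1 + y ^ 2)) - Real.arsinh (x / √(1 + y ^ 2))

theorem boostLength_neg (m x y : ℝ) : boostLength m (-x) (-y) = -boostLength m x y := by
  simp only [boostLength, neg_sq, mul_neg, neg_div, Real.arsinh_neg]
  ring

/-- With `ρ = √(1 + y²)`, a point of the hyperboloid has `x = ρ sinh u` and `t = ρ cosh u`. A boost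
by `s` keeps `y` and replaces `u` by `u + s`, so `ρ sinh (u + s) = m y` determines `s`. -/
theorem boostLength_spec {m x y t : ℝ} (ht : 0 < t) (h : t ^ 2 = 1 + x ^ 2 + y ^ 2) :
    x * Real.cosh (boostLength m x y) + t * Real.sinh (boostLength m x y) = m * y := by
  set ρ := √(1 + y ^ 2) with hρ
  have hρ0 : 0 < ρ := Real.sqrt_pos.2 (by positivity)
  have hρ2 : ρ ^ 2 = 1 + y ^ 2 := Real.sq_sqrt (by positivity)
  have h1 : Real.cosh (Real.arsinh (x / ρ)) = t / ρ := by
    rw [Real.cosh_arsinh, ← Real.sqrt_sq (by positivity : 0 ≤ t / ρ)]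
    congr 1
    field_simp
    linarith
  have h2 := Real.sinh_arsinh (m * y / ρ)
  have h3 : Real.arsinh (m * y / ρ) = boostLength m x y + Real.arsinh (x / ρ) := by
    simp only [boostLength, ← hρ]; ring
  rw [h3, Real.sinh_add, h1, Real.sinh_arsinh] at h2
  field_simp at h2
  linarith

theorem exists_rotation_boost (m m' : ℝ) {x y t x' y' t' : ℝ} (ht : 0 < t) (ht' : 0 < t')
    (h : t ^ 2 = 1 + x ^ 2 + y ^ 2) (h' : t' ^ 2 = 1 + x' ^ 2 + y' ^ 2) :
    ∃ θ s : ℝ,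
      (x * Real.cos θ - y * Real.sin θ) * Real.cosh s + t * Real.sinh s =
        m * (x * Real.sin θ + y * Real.cos θ) ∧
      (x' * Real.cos θ - y' * Real.sin θ) * Real.cosh s + t' * Real.sinh s =
        m' * (x' * Real.sin θ + y' * Real.cos θ) := by
  let F : ℝ → ℝ → ℝ → ℝ → ℝ := fun m x y θ =>
    boostLength m (x * Real.cos θ - y * Real.sin θ) (x * Real.sin θ + y * Real.cos θ)
  have hF : ∀ m x y, Continuous (F m x y) := by
    intro m x y
    simp only [F, boostLength]
    refine Continuous.sub (Real.continuous_arsinh.comp ?_) (Real.continuous_arsinh.comp ?_) <;>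
    refine Continuous.div (by fun_prop) (by fun_prop) fun θ => ?_ <;>
    exact (Real.sqrt_pos.2 (by positivity)).ne'
  -- Rotation by `π` negates both coordinates, and `boostLength` is odd.
  have hodd : ∀ m x y, F m x y Real.pi = -F m x y 0 := by
    intro m x y
    rw [← boostLength_neg]
    simp [F]
  have hrot : ∀ x y θ : ℝ, (x * Real.cos θ - y * Real.sin θ) ^ 2 +
      (x * Real.sin θ + y * Real.cos θ) ^ 2 = x ^ 2 + y ^ 2 := by
    intro x y θ
    linear_combination (x ^ 2 + y ^ 2) * Real.sin_sq_add_cos_sq θ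
  -- Intermediate value theorem: the difference of the two lengths takes opposite values at `0` and
  -- `π`. At a zero, one boost serves both points.
  obtain ⟨θ, hθ⟩ : (0 : ℝ) ∈ Set.range fun θ => F m x y θ - F m' x' y' θ := by
    have hπ : F m x y Real.pi - F m' x' y' Real.pi = -(F m x y 0 - F m' x' y' 0) := by
      rw [hodd, hodd]; ring
    rcases le_total 0 (F m x y 0 - F m' x' y' 0) with h0 | h0
    · exact mem_range_of_exists_le_of_exists_ge ((hF m x y).sub (hF m' x' y'))
        ⟨Real.pi, by simpa only [Pi.sub_apply, hπ, neg_nonpos] using h0⟩ ⟨0, h0⟩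
    · exact mem_range_of_exists_le_of_exists_ge ((hF m x y).sub (hF m' x' y'))
        ⟨0, h0⟩ ⟨Real.pi, by simpa only [Pi.sub_apply, hπ, neg_nonneg] using h0⟩
  refine ⟨θ, F m x y θ, boostLength_spec ht (by rw [add_assoc, hrot, h]; ring), ?_⟩
  rw [sub_eq_zero.1 hθ]
  exact boostLength_spec ht' (by rw [add_assoc, hrot, h']; ring)

theorem exp_boost_basepoint {n : ℕ} {v : Fin n → ℝ} (hv : v ⬝ᵥ v = 1) (s : ℝ) :
    NormedSpace.exp (s • gen 0 v) *ᵥ vec 0 1 = vec (Real.sinh s • v) (Real.cosh s) := by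
  have h := exp_boost hv (dotProduct_zero v) 0 1 s
  simpa using h

namespace LorentzModel

variable {𝕜 : Type} [RCLike 𝕜] {ι : Type} [Fintype ι] [DecidableEq ι]
  {G₀ : Subgroup (SpecialLinearGroup ι 𝕜)} {n : ℕ} (M : LorentzModel G₀ n)

theorem exists_rep_eq_exp {R : Matrix (Fin n) (Fin n) ℝ} (hR : Rᵀ = -R) (v : Fin n → ℝ) (s : ℝ) :
    ∃ g, M.rep g = NormedSpace.exp (s • gen R v) := by
  obtain ⟨X, hX⟩ := M.surj R v hR
  obtain ⟨g, -, hg⟩ := M.exists_exp (s • X)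
  exact ⟨g, by rw [hg, map_smul, hX]⟩

/-- Any vector can be rotated into a given line, by an element which fixes the vectors orthogonal
to both. -/
theorem exists_rotation_to_line {e : Fin n → ℝ} (he : e ⬝ᵥ e = 1) (ξ : Fin n → ℝ) :
    ∃ (k : G₀) (r : ℝ), (∀ t, M.rep k *ᵥ vec ξ t = vec (r • e) t) ∧
      ∀ η t, e ⬝ᵥ η = 0 → ξ ⬝ᵥ η = 0 → M.rep k *ᵥ vec η t = vec η t := by
  by_cases h0 : ξ - (e ⬝ᵥ ξ) • e = 0
  · refine ⟨1, e ⬝ᵥ ξ, fun t => ?_, fun η t _ _ => ?_⟩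
    · rw [map_one, one_mulVec, ← sub_eq_zero.1 h0]
    · rw [map_one, one_mulVec]
  obtain ⟨b, hb, f, hf, hξ⟩ := exists_normalize h0
  set a := e ⬝ᵥ ξ with ha
  have hfb : ∀ η, b * (f ⬝ᵥ η) = ξ ⬝ᵥ η - a * (e ⬝ᵥ η) := by
    intro η
    have h := congrArg (fun u => u ⬝ᵥ η) hξ
    simpa only [sub_dotProduct, smul_dotProduct, smul_eq_mul] using h.symm
  have hef : e ⬝ᵥ f = 0 := by
    have h := hfb e
    rw [he, dotProduct_comm ξ e, ← ha, mul_one, sub_self] at h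
    rw [dotProduct_comm]
    exact (mul_eq_zero.1 h).resolve_left hb.ne'
  have hξ' : ξ = a • e + b • f + 0 := by rw [← hξ]; module
  -- The angle for which the coefficient `a sin θ + b cos θ` of `f` vanishes.
  let θ := Real.pi / 2 + Real.arctan (a / b)
  obtain ⟨k, hk⟩ := M.exists_rep_eq_exp (wedge_transpose f e) 0 θ
  refine ⟨k, a * Real.cos θ - b * Real.sin θ, fun t => ?_, fun η t hη hη' => ?_⟩
  · have hθ : a * Real.sin θ + b * Real.cos θ = 0 := by
      have h1 : Real.sin θ = Real.cos (Real.arctan (a / b)) := by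
        rw [← Real.sin_pi_div_two_sub, ← Real.sin_pi_sub]; congr 1; simp only [θ]; ring
      have h2 : Real.cos θ = -Real.sin (Real.arctan (a / b)) := by
        simp only [θ]; rw [add_comm, Real.cos_add_pi_div_two]
      rw [h1, h2, Real.sin_arctan, Real.cos_arctan]
      field_simp
      ring
    rw [hk, hξ', exp_rotation he hf hef (dotProduct_zero e) (dotProduct_zero f), hθ, zero_smul,
      add_zero, add_zero]
  · have hfη : f ⬝ᵥ η = 0 := by
      have h := hfb η
      rw [hη, hη', mul_zero, sub_zero] at h
      exact (mul_eq_zero.1 h).resolve_left hb.ne'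
    have h := exp_rotation he hf hef hη hfη 0 0 t θ
    rw [hk]
    simpa using h

/-- Rotate the first point into the line of `e`, then rotate the part of the second orthogonal to
`e` into the line of `f`. The second rotation fixes `e`, so it does not disturb the first point. -/
theorem exists_move_to_plane {e f : Fin n → ℝ} (he : e ⬝ᵥ e = 1) (hf : f ⬝ᵥ f = 1)
    (hef : e ⬝ᵥ f = 0) (g g' : G₀) :
    ∃ k : G₀, M.rep k *ᵥ vec 0 1 = vec 0 1 ∧
      (∃ x y t : ℝ, M.rep (k * g) *ᵥ vec 0 1 = vec (x • e + y • f) t ∧ 0 < t ∧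
        t ^ 2 = 1 + x ^ 2 + y ^ 2) ∧
      ∃ x y t : ℝ, M.rep (k * g') *ᵥ vec 0 1 = vec (x • e + y • f) t ∧ 0 < t ∧
        t ^ 2 = 1 + x ^ 2 + y ^ 2 := by
  obtain ⟨ξ, t, hξ, -, -⟩ := M.orbit g
  obtain ⟨k, r, hk, hk'⟩ := M.exists_rotation_to_line he ξ
  obtain ⟨ξ', t', hξ', -, -⟩ := M.orbit (k * g')
  have hη : (ξ' - (e ⬝ᵥ ξ') • e) ⬝ᵥ e = 0 := by
    rw [sub_dotProduct, smul_dotProduct, he, dotProduct_comm, smul_eq_mul, mul_one, sub_self]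
  obtain ⟨l, r', hl, hl'⟩ := M.exists_rotation_to_line hf (ξ' - (e ⬝ᵥ ξ') • e)
  have hfe : f ⬝ᵥ e = 0 := by rw [dotProduct_comm, hef]
  have hle : ∀ c t : ℝ, M.rep l *ᵥ vec (c • e) t = vec (c • e) t := fun c t =>
    hl' _ t (by rw [dotProduct_smul, hfe, smul_zero]) (by rw [dotProduct_smul, hη, smul_zero])
  have hfin : ∀ (g : G₀) (x y t : ℝ), M.rep g *ᵥ vec 0 1 = vec (x • e + y • f) t →
      ∃ x y t : ℝ, M.rep g *ᵥ vec 0 1 = vec (x • e + y • f) t ∧ 0 < t ∧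
        t ^ 2 = 1 + x ^ 2 + y ^ 2 := by
    intro g x y t h
    obtain ⟨ζ, u, hζ, hu, hu'⟩ := M.orbit g
    obtain ⟨rfl, rfl⟩ := vec_inj.1 (h.symm.trans hζ)
    refine ⟨x, y, t, h, hu, ?_⟩
    rw [hu']
    simp only [add_dotProduct, dotProduct_add, smul_dotProduct, dotProduct_smul, he, hf, hef, hfe,
      smul_eq_mul]
    ring
  refine ⟨l * k, ?_, hfin (l * k * g) r 0 t ?_, hfin (l * k * g') (e ⬝ᵥ ξ') r' t' ?_⟩
  · rw [map_mul, ← mulVec_mulVec, hk' _ _ (dotProduct_zero _) (dotProduct_zero _),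
      hl' _ _ (dotProduct_zero _) (dotProduct_zero _)]
  · rw [map_mul, map_mul, ← mulVec_mulVec, ← mulVec_mulVec, hξ, hk, hle, zero_smul, add_zero]
  · rw [mul_assoc, map_mul, ← mulVec_mulVec, hξ']
    have : vec ξ' t' = vec ((e ⬝ᵥ ξ') • e) 0 + vec (ξ' - (e ⬝ᵥ ξ') • e) t' := by
      rw [vec_add, add_sub_cancel, zero_add]
    rw [this, mulVec_add, hle, hl, vec_add, zero_add]

/-- Any three points of hyperbolic space can be moved to the three geodesics through the base
point in the directions `e`, `c e + d f` and `c' e + d' f`. -/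
theorem exists_move_to_geodesics {e f : Fin n → ℝ} (he : e ⬝ᵥ e = 1) (hf : f ⬝ᵥ f = 1)
    (hef : e ⬝ᵥ f = 0) {c d c' d' : ℝ} (hd : d ≠ 0) (hd' : d' ≠ 0) (hcd : c ^ 2 + d ^ 2 = 1)
    (hcd' : c' ^ 2 + d' ^ 2 = 1) (g₀ g₁ g₂ : G₀) :
    ∃ (h : G₀) (s s₁ s₂ : ℝ),
      M.rep (h * g₀) *ᵥ vec 0 1 = NormedSpace.exp (s • gen 0 e) *ᵥ vec 0 1 ∧
      M.rep (h * g₁) *ᵥ vec 0 1 = NormedSpace.exp (s₁ • gen 0 (c • e + d • f)) *ᵥ vec 0 1 ∧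
      M.rep (h * g₂) *ᵥ vec 0 1 = NormedSpace.exp (s₂ • gen 0 (c' • e + d' • f)) *ᵥ vec 0 1 := by
  have hfe : f ⬝ᵥ e = 0 := by rw [dotProduct_comm, hef]
  obtain ⟨k, hk, ⟨x, y, t, hg, ht, hxy⟩, x', y', t', hg', ht', hxy'⟩ :=
    -- Left multiplication by `g₀⁻¹` brings the first point to the base point, which `k` and `ρ`
    -- then fix.
    M.exists_move_to_plane he hf hef (g₀⁻¹ * g₁) (g₀⁻¹ * g₂)
  obtain ⟨θ, s, h1, h2⟩ := exists_rotation_boost (c / d) (c' / d') ht ht' hxy hxy'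
  obtain ⟨ρ, hρ⟩ := M.exists_rep_eq_exp (wedge_transpose f e) 0 θ
  obtain ⟨b, hb⟩ := M.exists_rep_eq_exp (R := 0) (by simp) e s
  have hρ0 : M.rep ρ *ᵥ vec 0 1 = vec 0 1 := by
    have h := exp_rotation he hf hef (dotProduct_zero e) (dotProduct_zero f) 0 0 1 θ
    rw [hρ]
    simpa using h
  have key : ∀ (g : G₀) (x y t c d : ℝ), d ≠ 0 → c ^ 2 + d ^ 2 = 1 →
      M.rep (k * (g₀⁻¹ * g)) *ᵥ vec 0 1 = vec (x • e + y • f) t →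
      (x * Real.cos θ - y * Real.sin θ) * Real.cosh s + t * Real.sinh s =
        c / d * (x * Real.sin θ + y * Real.cos θ) →
      ∃ s' : ℝ, M.rep (b * ρ * k * g₀⁻¹ * g) *ᵥ vec 0 1 =
        NormedSpace.exp (s' • gen 0 (c • e + d • f)) *ᵥ vec 0 1 := by
    intro g x y t c d hd hcd hg hs
    have hv : (c • e + d • f) ⬝ᵥ (c • e + d • f) = 1 := by
      simp only [add_dotProduct, dotProduct_add, smul_dotProduct, dotProduct_smul, he, hf, hef, hfe,
        smul_eq_mul]
      linarith
    set Y := x * Real.sin θ + y * Real.cos θ with hY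
    have hpos : ∃ u, M.rep (b * ρ * k * g₀⁻¹ * g) *ᵥ vec 0 1 =
        vec ((Y / d) • (c • e + d • f)) u := by
      refine ⟨(x * Real.cos θ - y * Real.sin θ) * Real.sinh s + t * Real.cosh s, ?_⟩
      have e1 : b * ρ * k * g₀⁻¹ * g = b * (ρ * (k * (g₀⁻¹ * g))) := by group
      rw [e1, map_mul, map_mul, ← mulVec_mulVec, ← mulVec_mulVec, hg, hρ, hb,
        ← add_zero (x • e + y • f),
        exp_rotation he hf hef (dotProduct_zero e) (dotProduct_zero f), ← hY, add_zero,
        exp_boost he (by rw [dotProduct_smul, hef, smul_zero]), hs]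
      congr 1
      rw [smul_add, smul_smul, smul_smul, div_mul_cancel₀ _ hd]
      congr 2
      ring
    obtain ⟨u, hu⟩ := hpos
    obtain ⟨ζ, w, hζ, hw, hw'⟩ := M.orbit (b * ρ * k * g₀⁻¹ * g)
    obtain ⟨rfl, rfl⟩ := vec_inj.1 (hu.symm.trans hζ)
    -- The spatial part has signed length `Y / d` along the unit direction; the time coordinate is
    -- then forced, being positive on the hyperboloid.
    refine ⟨Real.arsinh (Y / d), ?_⟩
    rw [hu, exp_boost_basepoint hv, Real.sinh_arsinh, Real.cosh_arsinh]
    congr 1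
    rw [smul_dotProduct, dotProduct_smul, hv, smul_eq_mul, smul_eq_mul, mul_one, ← sq] at hw'
    rw [← hw', Real.sqrt_sq hw.le]
  obtain ⟨s₁, hs₁⟩ := key g₁ x y t c d hd hcd hg h1
  obtain ⟨s₂, hs₂⟩ := key g₂ x' y' t' c' d' hd' hcd' hg' h2
  refine ⟨b * ρ * k * g₀⁻¹, s, s₁, s₂, ?_, hs₁, hs₂⟩
  rw [inv_mul_cancel_right, map_mul, map_mul, ← mulVec_mulVec, ← mulVec_mulVec, hk, hρ0, hb]

theorem polarDecomposition_of_isPlanarTriple (M : LorentzModel G₀ n) (hn : 2 ≤ n)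
    {a : Fin 3 → Submodule ℝ (lieAlg G₀)} (ha : IsPlanarTriple G₀ a) :
    PolarDecomposition G₀ (prod₃ a) := by
  obtain ⟨e, f, X, Y, Z, c, c', d, d', he, hf, hef, hd, hd', hcd, hcd', hXa, hYa, hZa, hX, hY,
    hZ⟩ := M.exists_frame_of_isPlanarTriple hn ha
  rw [PolarDecomposition, Set.eq_univ_iff_forall]
  intro g
  -- Inverses appear because `gⱼ = kⱼ aⱼ h` amounts to `h gⱼ⁻¹ = aⱼ⁻¹ kⱼ⁻¹`, so that `h gⱼ⁻¹` sends
  -- the base point to a point of the `j`-th geodesic.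
  obtain ⟨h, s, s₁, s₂, h0, h1, h2⟩ := M.exists_move_to_geodesics he hf hef hd hd' hcd hcd'
    (g 0)⁻¹ (g 1)⁻¹ (g 2)⁻¹
  have hj : ∀ j, ∃ U ∈ a j, M.rep (h * (g j)⁻¹) *ᵥ vec 0 1 =
      NormedSpace.exp (M.drep U) *ᵥ vec 0 1 := by
    intro j
    match j with
    | 0 => exact ⟨s • X, Submodule.smul_mem _ _ hXa, by rw [h0, map_smul, hX]⟩
    | 1 => exact ⟨s₁ • Y, Submodule.smul_mem _ _ hYa, by rw [h1, map_smul, hY]⟩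
    | 2 => exact ⟨s₂ • Z, Submodule.smul_mem _ _ hZa, by rw [h2, map_smul, hZ]⟩
  choose U hUa hU using hj
  choose A hA hA' using fun j => M.exists_exp (-U j)
  have hK : ∀ j, A j * (h * (g j)⁻¹) ∈ K₀ G₀ := by
    intro j
    apply M.stab
    rw [map_mul, ← mulVec_mulVec, hU, hA', mulVec_mulVec, map_neg, exp_neg_mul_exp, one_mulVec]
  refine Set.mem_mul.2 ⟨(fun j => (A j * (h * (g j)⁻¹))⁻¹) * A, Set.mul_mem_mul ?_ ?_,
    fun _ => h, ⟨h, rfl⟩, ?_⟩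
  · exact fun j _ => inv_mem (hK j)
  · exact ⟨-U, mem_prod₃.2 fun j => neg_mem (hUa j), hA⟩
  · funext j
    simp only [Pi.mul_apply]
    group

theorem polar_and_spherical_decomposition (M : LorentzModel G₀ n) (hn : 2 ≤ n) :
    (∃ a : Fin 3 → Submodule ℝ (lieAlg G₀), IsPlanarTriple G₀ a) ∧
    ∀ a : Fin 3 → Submodule ℝ (lieAlg G₀), IsPlanarTriple G₀ a →
      IsMaximalAbelianIn (prod₃ fun _ => s₀ G₀) (prod₃ a) ∧
      PolarDecomposition G₀ (prod₃ a) ∧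
      ∀ p : Submodule ℝ (Fin 3 → lieAlg G₀),
        IsMinimalParabolic (prod₃ fun _ => k₀ G₀) (prod₃ fun _ => s₀ G₀) p →
        prod₃ a ≤ p → SphericalDecomposition G₀ p :=
  ⟨M.exists_isPlanarTriple hn, fun _ ha => ⟨isMaximalAbelianIn_prod₃ ha.1,
    M.polarDecomposition_of_isPlanarTriple hn ha, fun _ hp hap =>
      M.sphericalDecomposition_of_isPlanarTriple hn ha hp hap⟩⟩

end LorentzModel

/-! ### The model of `SO_e(n,1)` -/

section SOe

open LieAlgebra.Orthogonal

variable {n : ℕ}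

theorem gen_transpose (R : Matrix (Fin n) (Fin n) ℝ) (v : Fin n → ℝ) :
    (gen R v)ᵀ = gen Rᵀ v := by
  rw [gen, gen, fromBlocks_transpose, transpose_replicateCol, transpose_replicateRow,
    transpose_zero]

theorem neg_gen (R : Matrix (Fin n) (Fin n) ℝ) (v : Fin n → ℝ) : -gen R v = gen (-R) (-v) := by
  simpa using smul_gen (-1) R v

theorem indefiniteDiagonal_eq_fromBlocks :
    indefiniteDiagonal (Fin n) (Fin 1) ℝ = fromBlocks 1 0 0 (-1) := by
  ext (i | i) (j | j) <;> simp [indefiniteDiagonal, diagonal_apply, Matrix.one_apply, apply_ite]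

theorem indefiniteDiagonal_mul_self :
    indefiniteDiagonal (Fin n) (Fin 1) ℝ * indefiniteDiagonal (Fin n) (Fin 1) ℝ = 1 := by
  rw [indefiniteDiagonal_eq_fromBlocks, fromBlocks_multiply]
  simp

theorem transpose_mul_indefiniteDiagonal_iff
    (X : Matrix (Fin n ⊕ Fin 1) (Fin n ⊕ Fin 1) ℝ) :
    Xᵀ * indefiniteDiagonal (Fin n) (Fin 1) ℝ = -(indefiniteDiagonal (Fin n) (Fin 1) ℝ * X) ↔
      ∃ R v, Rᵀ = -R ∧ X = gen R v := by
  rw [indefiniteDiagonal_eq_fromBlocks]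
  constructor
  · intro h
    rw [← fromBlocks_toBlocks X] at h
    simp only [fromBlocks_transpose, fromBlocks_multiply, Matrix.mul_one, Matrix.one_mul,
      Matrix.mul_zero, Matrix.zero_mul, zero_add, add_zero, fromBlocks_neg, fromBlocks_inj,
      Matrix.mul_neg, Matrix.neg_mul, neg_neg] at h
    obtain ⟨h1, h2, h3, h4⟩ := h
    refine ⟨X.toBlocks₁₁, fun i => X (Sum.inl i) (Sum.inr 0), h1, ?_⟩
    rw [gen, ← fromBlocks_toBlocks X]
    simp only [toBlocks_fromBlocks₁₁, fromBlocks_inj]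
    refine ⟨trivial, ?_, ?_, ?_⟩
    · ext i j
      fin_cases j
      rfl
    · ext i j
      fin_cases i
      exact (congrFun (congrFun h3 0) j).symm
    · ext i j
      fin_cases i
      fin_cases j
      have h : -X.toBlocks₂₂ 0 0 = X.toBlocks₂₂ 0 0 := congrFun (congrFun h4 0) 0
      exact neg_eq_self.1 h
  · rintro ⟨R, v, hR, rfl⟩
    rw [gen_transpose, hR, gen, gen, fromBlocks_multiply, fromBlocks_multiply, fromBlocks_neg]
    simp

theorem exp_transpose_mul_indefiniteDiagonal_mul {R : Matrix (Fin n) (Fin n) ℝ} (hR : Rᵀ = -R)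
    (v : Fin n → ℝ) :
    (NormedSpace.exp (gen R v))ᵀ * indefiniteDiagonal (Fin n) (Fin 1) ℝ *
      NormedSpace.exp (gen R v) = indefiniteDiagonal (Fin n) (Fin 1) ℝ := by
  set J := indefiniteDiagonal (Fin n) (Fin 1) ℝ with hJ
  have hJJ : J * J = 1 := indefiniteDiagonal_mul_self
  have hinv : J⁻¹ = J := inv_eq_left_inv hJJ
  have hX : (gen R v)ᵀ = J * -(gen R v) * J⁻¹ := by
    rw [hinv, Matrix.mul_neg, ← (transpose_mul_indefiniteDiagonal_iff _).2 ⟨R, v, hR, rfl⟩,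
      Matrix.mul_assoc, ← hJ, hJJ, Matrix.mul_one]
  rw [← Matrix.exp_transpose, hX, Matrix.exp_conj _ _ (IsUnit.of_mul_eq_one _ hJJ), hinv,
    Matrix.mul_assoc _ J J, hJJ, Matrix.mul_one, Matrix.mul_assoc, exp_neg_mul_exp, Matrix.mul_one]

/-- Preserving the form gives determinant of square one; halving the exponent writes the determinant
of the exponential as such a square. -/
theorem det_exp_gen {R : Matrix (Fin n) (Fin n) ℝ} (hR : Rᵀ = -R) (v : Fin n → ℝ) :
    (NormedSpace.exp (gen R v)).det = 1 := by
  have hR' : ((2⁻¹ : ℝ) • R)ᵀ = -((2⁻¹ : ℝ) • R) := by rw [transpose_smul, hR, smul_neg]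
  have h := congrArg det (exp_transpose_mul_indefiniteDiagonal_mul hR' ((2⁻¹ : ℝ) • v))
  have hJ : (indefiniteDiagonal (Fin n) (Fin 1) ℝ).det ≠ 0 := by
    intro h0
    have := congrArg det (indefiniteDiagonal_mul_self (n := n))
    rw [det_mul, h0, mul_zero, det_one] at this
    exact zero_ne_one this
  rw [det_mul, det_mul, det_transpose] at h
  have hg : gen R v = gen ((2⁻¹ : ℝ) • R) ((2⁻¹ : ℝ) • v) + gen ((2⁻¹ : ℝ) • R) ((2⁻¹ : ℝ) • v) := by
    rw [← smul_gen, ← add_smul]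
    norm_num
  rw [hg, Matrix.exp_add_of_commute _ _ (Commute.refl _), det_mul]
  have h2 : ((NormedSpace.exp (gen ((2⁻¹ : ℝ) • R) ((2⁻¹ : ℝ) • v))).det *
      (NormedSpace.exp (gen ((2⁻¹ : ℝ) • R) ((2⁻¹ : ℝ) • v))).det - 1) *
      (indefiniteDiagonal (Fin n) (Fin 1) ℝ).det = 0 := by linarith
  exact sub_eq_zero.1 ((mul_eq_zero.1 h2).resolve_right hJ)

/-- The path `t ↦ exp(tX)` stays in `SO n` and joins the identity to `exp X`. -/
theorem exists_mem_SOe_eq_exp {R : Matrix (Fin n) (Fin n) ℝ} (hR : Rᵀ = -R) (v : Fin n → ℝ) :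
    ∃ g ∈ SOe n, (g : Matrix (Fin n ⊕ Fin 1) (Fin n ⊕ Fin 1) ℝ) =
      NormedSpace.exp (gen R v) := by
  have hR' : ∀ t : ℝ, (t • R)ᵀ = -(t • R) := fun t => by rw [transpose_smul, hR, smul_neg]
  let γ : ℝ → SO n := fun t =>
    ⟨⟨NormedSpace.exp (t • gen R v), by rw [smul_gen]; exact det_exp_gen (hR' t) _⟩, by
      change (NormedSpace.exp (t • gen R v))ᵀ * _ * NormedSpace.exp (t • gen R v) = _
      rw [smul_gen]
      exact exp_transpose_mul_indefiniteDiagonal_mul (hR' t) _⟩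
  have hγ : Continuous γ := by
    refine Continuous.subtype_mk (Continuous.subtype_mk ?_ _) _
    refine continuous_pi fun i => continuous_pi fun j => ?_
    exact continuous_iff_continuousAt.2 fun t =>
      (hasDerivAt_exp_smul_apply (gen R v) t i j).continuousAt
  have h0 : γ 0 = 1 := by
    apply Subtype.ext
    apply Subtype.ext
    change NormedSpace.exp ((0 : ℝ) • gen R v) = 1
    rw [zero_smul, NormedSpace.exp_zero]
  have h1 : γ 1 ∈ connectedComponent (1 : SO n) :=
    (isPreconnected_range hγ).subset_connectedComponent ⟨0, h0⟩ ⟨1, rfl⟩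
  refine ⟨(γ 1).1, ⟨γ 1, h1, rfl⟩, ?_⟩
  change NormedSpace.exp ((1 : ℝ) • gen R v) = _
  rw [one_smul]

theorem SOe_le_SO : SOe n ≤ SO n := by
  rintro _ ⟨g, -, rfl⟩
  exact g.2

/-- Differentiate the invariance of the form at `t = 0`. -/
theorem exists_eq_gen_of_forall_exp_mem {X : Matrix (Fin n ⊕ Fin 1) (Fin n ⊕ Fin 1) ℝ}
    (hX : ∀ t : ℝ, ∃ g ∈ SOe n, (g : Matrix (Fin n ⊕ Fin 1) (Fin n ⊕ Fin 1) ℝ) =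
      NormedSpace.exp (t • X)) : ∃ R v, Rᵀ = -R ∧ X = gen R v := by
  rw [← transpose_mul_indefiniteDiagonal_iff]
  set J := indefiniteDiagonal (Fin n) (Fin 1) ℝ with hJ
  have h : ∀ t : ℝ, (NormedSpace.exp (t • X))ᵀ * J = J * NormedSpace.exp (t • -X) := by
    intro t
    obtain ⟨g, hg, hgX⟩ := hX t
    have h : (g.1)ᵀ * J * g.1 = J := SOe_le_SO hg
    rw [hgX] at h
    rw [← Matrix.mul_one (_ * J), ← exp_mul_exp_neg (t • X), ← Matrix.mul_assoc, h, smul_neg]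
  ext i j
  have h1 := HasDerivAt.fun_sum (u := Finset.univ) (fun k _ =>
    (hasDerivAt_exp_smul_apply X 0 k i).mul_const (J k j))
  have h2 := HasDerivAt.fun_sum (u := Finset.univ) (fun k _ =>
    (hasDerivAt_exp_smul_apply (-X) 0 k j).const_mul (J i k))
  have h3 := h1.unique (h2.congr_of_eventuallyEq
    (Filter.Eventually.of_forall fun t => congrFun (congrFun (h t) i) j))
  simp only [zero_smul, NormedSpace.exp_zero, Matrix.mul_one] at h3
  rw [← Matrix.mul_neg]
  exact h3

theorem mem_lieAlg_SOe {X : Matrix (Fin n ⊕ Fin 1) (Fin n ⊕ Fin 1) ℝ} :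
    X ∈ lieAlg (SOe n) ↔ ∃ R v, Rᵀ = -R ∧ X = gen R v := by
  constructor
  · let L : LieSubalgebra ℝ (Matrix (Fin n ⊕ Fin 1) (Fin n ⊕ Fin 1) ℝ) :=
      { carrier := {X | ∃ R v, Rᵀ = -R ∧ X = gen R v}
        zero_mem' := ⟨0, 0, by simp, gen_zero.symm⟩
        add_mem' := by
          rintro _ _ ⟨R, v, hR, rfl⟩ ⟨S, w, hS, rfl⟩
          exact ⟨R + S, v + w, by rw [transpose_add, hR, hS]; abel, gen_add _ _ _ _⟩
        smul_mem' := by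
          rintro c _ ⟨R, v, hR, rfl⟩
          exact ⟨c • R, c • v, by rw [transpose_smul, hR, smul_neg], smul_gen _ _ _⟩
        lie_mem' := by
          rintro _ _ ⟨R, v, hR, rfl⟩ ⟨S, w, hS, rfl⟩
          refine ⟨_, _, ?_, lie_gen hR hS v w⟩
          rw [transpose_add, wedge_transpose, Ring.lie_def, transpose_sub, transpose_mul,
            transpose_mul, hR, hS, Matrix.neg_mul, Matrix.neg_mul, Matrix.mul_neg, Matrix.mul_neg]
          abel }
    have hle : lieAlg (SOe n) ≤ L :=
      LieSubalgebra.lieSpan_le.2 fun X hX => exists_eq_gen_of_forall_exp_mem hX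
    exact fun hX => hle hX
  · rintro ⟨R, v, hR, rfl⟩
    refine LieSubalgebra.subset_lieSpan fun t => ?_
    rw [smul_gen]
    exact exists_mem_SOe_eq_exp (by rw [transpose_smul, hR, smul_neg]) _

theorem sq_eq_of_mem_SO {g : SpecialLinearGroup (Fin n ⊕ Fin 1) ℝ} (hg : g ∈ SO n)
    {ξ : Fin n → ℝ} {t : ℝ} (h : g.1 *ᵥ vec 0 1 = vec ξ t) : t ^ 2 = 1 + ξ ⬝ᵥ ξ := by
  have hJ : ∀ (η : Fin n → ℝ) (s : ℝ),
      vec η s ⬝ᵥ (indefiniteDiagonal (Fin n) (Fin 1) ℝ *ᵥ vec η s) = η ⬝ᵥ η - s ^ 2 := by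
    intro η s
    simp [vec, indefiniteDiagonal_eq_fromBlocks, fromBlocks_mulVec, Function.comp_def, neg_mulVec,
      dotProduct, sq]
    ring
  have hg' : g.1ᵀ * indefiniteDiagonal (Fin n) (Fin 1) ℝ * g.1 = _ := hg
  have h1 := congrArg (fun A => vec 0 1 ⬝ᵥ (A *ᵥ vec 0 1)) hg'
  simp only [← mulVec_mulVec, h, hJ] at h1
  rw [dotProduct_mulVec, vecMul_transpose, h, hJ] at h1
  simp at h1
  linarith

/-- On `SO n` the time coordinate of the moved base point satisfies `t² ≥ 1`, so it never vanishes;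
on the identity component it keeps the sign it has at the identity. -/
theorem pos_of_mem_SOe {g : SpecialLinearGroup (Fin n ⊕ Fin 1) ℝ} (hg : g ∈ SOe n) :
    0 < (g.1 *ᵥ vec 0 1) (Sum.inr 0) := by
  obtain ⟨g, hg, rfl⟩ := hg
  let F : SO n → ℝ := fun g => (g.1.1 *ᵥ vec 0 1) (Sum.inr 0)
  have hval : Continuous fun g : SO n => (g.1.1 : Matrix (Fin n ⊕ Fin 1) (Fin n ⊕ Fin 1) ℝ) := by
    have h : Continuous fun g : SpecialLinearGroup (Fin n ⊕ Fin 1) ℝ =>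
      (g.1 : Matrix (Fin n ⊕ Fin 1) (Fin n ⊕ Fin 1) ℝ) := continuous_subtype_val
    have h' : Continuous fun g : SO n => g.1 := continuous_subtype_val
    exact h.comp h'
  have hF : Continuous F :=
    (continuous_apply (Sum.inr 0)).comp (hval.matrix_mulVec continuous_const)
  have hne : ∀ g, F g ≠ 0 := by
    intro g h0
    obtain ⟨ξ, t, h⟩ := vec_surj (g.1.1 *ᵥ vec 0 1)
    have h1 := sq_eq_of_mem_SO g.2 h
    have h2 : F g = t := by simp only [F, h]; rfl
    have h3 : 0 ≤ ξ ⬝ᵥ ξ := Finset.sum_nonneg fun i _ => mul_self_nonneg _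
    rw [← h2, h0] at h1
    linarith
  have h1 : F 1 = 1 := by
    change ((1 : Matrix (Fin n ⊕ Fin 1) (Fin n ⊕ Fin 1) ℝ) *ᵥ vec 0 1) (Sum.inr 0) = 1
    rw [one_mulVec]
    rfl
  by_contra hneg
  have hle : F g ≤ 0 := not_lt.1 hneg
  obtain ⟨k, -, hk⟩ := (isPreconnected_connectedComponent (x := (1 : SO n))).intermediate_value
    hg mem_connectedComponent hF.continuousOn ⟨hle, by rw [h1]; exact zero_le_one⟩
  exact hne k hk

theorem mem_unitary_of_mem_SO {g : SpecialLinearGroup (Fin n ⊕ Fin 1) ℝ} (hg : g ∈ SO n)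
    (h : g.1 *ᵥ vec 0 1 = vec 0 1) : g.1 ∈ unitary (Matrix (Fin n ⊕ Fin 1) (Fin n ⊕ Fin 1) ℝ) := by
  have hg' : g.1ᵀ * indefiniteDiagonal (Fin n) (Fin 1) ℝ * g.1 =
    indefiniteDiagonal (Fin n) (Fin 1) ℝ := hg
  -- The form differs from the Euclidean one by a rank-one term in the base point. That point is
  -- fixed by `g` and by its transpose, so `g` preserves the Euclidean form as well.
  have hJ : indefiniteDiagonal (Fin n) (Fin 1) ℝ = 1 - (2 : ℝ) • vecMulVec (vec 0 1) (vec 0 1) := by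
    rw [indefiniteDiagonal_eq_fromBlocks]
    ext (i | i) (j | j)
    · simp [vec, vecMulVec_apply, Matrix.one_apply]
    · simp [vec, vecMulVec_apply]
    · simp [vec, vecMulVec_apply]
    · fin_cases i
      fin_cases j
      norm_num [vec, vecMulVec_apply]
  have hJo : indefiniteDiagonal (Fin n) (Fin 1) ℝ *ᵥ vec 0 1 = -vec 0 1 := by
    rw [indefiniteDiagonal_eq_fromBlocks, vec, fromBlocks_mulVec]
    funext i
    rcases i with i | i <;> simp [Function.comp_def, neg_mulVec]
  have ho : g.1ᵀ *ᵥ vec 0 1 = vec 0 1 := by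
    have h1 := congrArg (fun A => A *ᵥ vec 0 1) hg'
    simp only [← mulVec_mulVec, h, hJo, mulVec_neg, neg_inj] at h1
    exact h1
  have h1 : g.1ᵀ * g.1 = 1 := by
    rw [hJ, Matrix.mul_sub, Matrix.sub_mul, Matrix.mul_one, Matrix.mul_smul, Matrix.smul_mul,
      mul_vecMulVec, vecMulVec_mul, ho, ← mulVec_transpose, ho] at hg'
    exact sub_left_injective hg'
  rw [Unitary.mem_iff, star_eq_conjTranspose, conjTranspose_eq_transpose_of_trivial]
  exact ⟨h1, mul_eq_one_comm.1 h1⟩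

/-- The standard representation of `SO_e(n,1)`. -/
noncomputable def modelSOe (n : ℕ) : LorentzModel (SOe n) n where
  rep :=
    { toFun := fun g => g.1.1
      map_one' := rfl
      map_mul' := fun _ _ => rfl }
  drep := (lieAlg (SOe n)).incl
  inj := Subtype.val_injective
  exists_eq_gen X := mem_lieAlg_SOe.1 X.2
  surj R v hR := ⟨⟨gen R v, mem_lieAlg_SOe.2 ⟨R, v, hR, rfl⟩⟩, rfl⟩
  mem_k₀ X := by
    obtain ⟨R, v, hR, hX⟩ := mem_lieAlg_SOe.1 X.2
    change (X : Matrix _ _ ℝ)ᴴ = -X.1 ↔ ∃ R, X.1 = gen R 0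
    rw [conjTranspose_eq_transpose_of_trivial, hX, gen_transpose, neg_gen, gen_inj, hR]
    constructor
    · intro h
      exact ⟨R, by rw [self_eq_neg.1 h.2]⟩
    · rintro ⟨S, hS⟩
      rw [(gen_inj.1 hS).2]
      simp
  mem_s₀ X := by
    obtain ⟨R, v, hR, hX⟩ := mem_lieAlg_SOe.1 X.2
    change (X : Matrix _ _ ℝ)ᴴ = X.1 ↔ ∃ v, X.1 = gen 0 v
    rw [conjTranspose_eq_transpose_of_trivial, hX, gen_transpose, gen_inj, hR]
    constructor
    · intro h
      refine ⟨v, gen_inj.2 ⟨?_, rfl⟩⟩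
      ext i j
      exact neg_eq_self.1 (congrFun (congrFun h.1 i) j)
    · rintro ⟨w, hw⟩
      rw [(gen_inj.1 hw).1]
      simp
  exists_exp X := by
    obtain ⟨R, v, hR, hX⟩ := mem_lieAlg_SOe.1 X.2
    obtain ⟨g, hg, hgX⟩ := exists_mem_SOe_eq_exp hR v
    rw [← hX] at hgX
    exact ⟨⟨g, hg⟩, hgX, hgX⟩
  orbit g := by
    obtain ⟨ξ, t, h⟩ := vec_surj (g.1.1 *ᵥ vec 0 1)
    refine ⟨ξ, t, h, ?_, sq_eq_of_mem_SO (SOe_le_SO g.2) h⟩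
    have := pos_of_mem_SOe g.2
    rwa [h] at this
  stab g h := mem_unitary_of_mem_SO (SOe_le_SO g.2) h

end SOe

/-! ### The models of `SL(2,ℝ)` and `SL(2,ℂ)` -/

section SL2

variable {𝕜 : Type} [RCLike 𝕜] {n : ℕ}

/-- Coordinates of a `2 × 2` matrix with respect to a family `σ` of Hermitian matrices. -/
noncomputable def coord (σ : Fin n ⊕ Fin 1 → Matrix (Fin 2) (Fin 2) 𝕜) :
    Matrix (Fin 2) (Fin 2) 𝕜 →ₗ[ℝ] (Fin n ⊕ Fin 1 → ℝ) where
  toFun N i := RCLike.re (trace (σ i * N)) / 2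
  map_add' N N' := by
    funext i
    simp only [Matrix.mul_add, trace_add, map_add, Pi.add_apply, add_div]
  map_smul' c N := by
    funext i
    simp only [Matrix.mul_smul, trace_smul, RCLike.smul_re, Pi.smul_apply, smul_eq_mul, mul_div_assoc,
      RingHom.id_apply]

/-- The matrix with given coordinates with respect to a family `σ` of matrices. -/
noncomputable def combine (σ : Fin n ⊕ Fin 1 → Matrix (Fin 2) (Fin 2) 𝕜) :
    (Fin n ⊕ Fin 1 → ℝ) →ₗ[ℝ] Matrix (Fin 2) (Fin 2) 𝕜 where
  toFun x := ∑ j, x j • σ j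
  map_add' x y := by simp only [Pi.add_apply, add_smul, Finset.sum_add_distrib]
  map_smul' c x := by
    simp only [Pi.smul_apply, smul_eq_mul, mul_smul, Finset.smul_sum, RingHom.id_apply]

/-- An orthonormal basis of the Hermitian `2 × 2` matrices which consists of the identity and of
anticommuting traceless matrices. -/
structure IsPauliBasis (σ : Fin n ⊕ Fin 1 → Matrix (Fin 2) (Fin 2) 𝕜) : Prop where
  isHermitian : ∀ i, (σ i)ᴴ = σ i
  one : σ (Sum.inr 0) = 1
  anticomm : ∀ i j, σ (Sum.inl i) * σ (Sum.inl j) + σ (Sum.inl j) * σ (Sum.inl i) =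
    (if i = j then (2 : ℝ) else 0) • 1
  trace_eq_zero : ∀ i, trace (σ (Sum.inl i)) = 0
  coord_self : ∀ j, coord σ (σ j) = Pi.single j 1
  combine_coord : ∀ N : Matrix (Fin 2) (Fin 2) 𝕜, Nᴴ = N → combine σ (coord σ N) = N
  re_det : ∀ N : Matrix (Fin 2) (Fin 2) 𝕜, Nᴴ = N → RCLike.re N.det =
    coord σ N (Sum.inr 0) ^ 2 - ∑ i, coord σ N (Sum.inl i) ^ 2
  central : ∀ X : Matrix (Fin 2) (Fin 2) 𝕜, (∀ j, X * σ j = σ j * X) → trace X = 0 → X = 0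

/-- Liouville's formula; it identifies the Lie algebra of `SL(2)` with the traceless matrices. -/
theorem hasDerivAt_det_exp (X : Matrix (Fin 2) (Fin 2) 𝕜) (t : ℝ) :
    HasDerivAt (fun t : ℝ => (NormedSpace.exp (t • X) : Matrix (Fin 2) (Fin 2) 𝕜).det)
      (trace X * (NormedSpace.exp (t • X) : Matrix (Fin 2) (Fin 2) 𝕜).det) t := by
  have h := hasDerivAt_exp_smul_apply X t
  simp only [det_fin_two]
  refine (((h 0 0).mul (h 1 1)).sub ((h 0 1).mul (h 1 0))).congr_deriv ?_
  simp only [Matrix.mul_apply, Fin.sum_univ_two, trace_fin_two]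
  ring

theorem det_exp_smul_eq_one {X : Matrix (Fin 2) (Fin 2) 𝕜} (hX : trace X = 0) (t : ℝ) :
    (NormedSpace.exp (t • X) : Matrix (Fin 2) (Fin 2) 𝕜).det = 1 := by
  have hd := fun t => (hasDerivAt_det_exp X t).congr_deriv (by rw [hX, zero_mul])
  rw [is_const_of_deriv_eq_zero (fun t => (hd t).differentiableAt) (fun t => (hd t).deriv) t 0,
    zero_smul, NormedSpace.exp_zero, det_one]

theorem mem_lieAlg_top {X : Matrix (Fin 2) (Fin 2) 𝕜} :
    X ∈ lieAlg (⊤ : Subgroup (SpecialLinearGroup (Fin 2) 𝕜)) ↔ trace X = 0 := by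
  constructor
  · let L : LieSubalgebra ℝ (Matrix (Fin 2) (Fin 2) 𝕜) :=
      { carrier := {X | trace X = 0}
        zero_mem' := trace_zero _ _
        add_mem' := fun {X Y} hX hY => by
          change trace (X + Y) = 0
          rw [trace_add, hX, hY, add_zero]
        smul_mem' := fun c X hX => by
          change trace (c • X) = 0
          rw [trace_smul, hX, smul_zero]
        lie_mem' := fun {X Y} _ _ => by
          change trace ⁅X, Y⁆ = 0
          rw [Ring.lie_def, trace_sub, trace_mul_comm, sub_self] }
    have hle : lieAlg (⊤ : Subgroup (SpecialLinearGroup (Fin 2) 𝕜)) ≤ L := by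
      refine LieSubalgebra.lieSpan_le.2 fun X hX => ?_
      have hdet : ∀ t : ℝ, (NormedSpace.exp (t • X) : Matrix (Fin 2) (Fin 2) 𝕜).det = 1 := by
        intro t
        obtain ⟨g, -, hg⟩ := hX t
        rw [← hg]
        exact g.2
      have h := (hasDerivAt_det_exp X 0).unique
        ((hasDerivAt_const (0 : ℝ) (1 : 𝕜)).congr_of_eventuallyEq
          (Filter.Eventually.of_forall hdet))
      rwa [hdet, mul_one] at h
    exact fun hX => hle hX
  · intro hX
    exact LieSubalgebra.subset_lieSpan fun t =>
      ⟨⟨_, det_exp_smul_eq_one hX t⟩, Subgroup.mem_top _, rfl⟩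

theorem vec_zero_one : vec (n := n) 0 1 = Pi.single (Sum.inr 0) 1 := by
  funext i
  rcases i with i | i
  · simp [vec]
  · fin_cases i
    simp [vec]

namespace IsPauliBasis

variable {σ : Fin n ⊕ Fin 1 → Matrix (Fin 2) (Fin 2) 𝕜} (hσ : IsPauliBasis σ)
include hσ

omit hσ in
theorem combine_single (j : Fin n ⊕ Fin 1) : combine σ (Pi.single j 1) = σ j := by
  change ∑ k, (Pi.single j (1 : ℝ) : Fin n ⊕ Fin 1 → ℝ) k • σ k = σ j
  rw [Finset.sum_eq_single j]
  · simp
  · intro k _ hk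
    rw [Pi.single_eq_of_ne hk, zero_smul]
  · simp

theorem combine_isHermitian (x : Fin n ⊕ Fin 1 → ℝ) : (combine σ x)ᴴ = combine σ x := by
  change (∑ j, x j • σ j)ᴴ = ∑ j, x j • σ j
  rw [conjTranspose_sum]
  exact Finset.sum_congr rfl fun j _ => by
    rw [conjTranspose_smul, hσ.isHermitian, star_trivial]

theorem coord_combine (x : Fin n ⊕ Fin 1 → ℝ) : coord σ (combine σ x) = x := by
  change coord σ (∑ j, x j • σ j) = x
  rw [map_sum]
  simp only [map_smul, hσ.coord_self]
  funext i
  simp [Finset.sum_apply, Pi.single_apply]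

theorem eq_zero_of_coord {N : Matrix (Fin 2) (Fin 2) 𝕜} (hN : Nᴴ = N) (h : coord σ N = 0) :
    N = 0 := by
  rw [← hσ.combine_coord N hN, h, map_zero]

omit hσ in
/-- The action `N ↦ g N g*` of a matrix on Hermitian matrices, in coordinates. -/
noncomputable def act (σ : Fin n ⊕ Fin 1 → Matrix (Fin 2) (Fin 2) 𝕜)
    (g : Matrix (Fin 2) (Fin 2) 𝕜) : Matrix (Fin n ⊕ Fin 1) (Fin n ⊕ Fin 1) ℝ :=
  LinearMap.toMatrix' (coord σ ∘ₗ LinearMap.mulRight ℝ gᴴ ∘ₗ LinearMap.mulLeft ℝ g ∘ₗ combine σ)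

omit hσ in
/-- The action `N ↦ X N + N X*` of a matrix on Hermitian matrices, in coordinates. -/
noncomputable def dact (σ : Fin n ⊕ Fin 1 → Matrix (Fin 2) (Fin 2) 𝕜)
    (X : Matrix (Fin 2) (Fin 2) 𝕜) : Matrix (Fin n ⊕ Fin 1) (Fin n ⊕ Fin 1) ℝ :=
  LinearMap.toMatrix' (coord σ ∘ₗ (LinearMap.mulLeft ℝ X + LinearMap.mulRight ℝ Xᴴ) ∘ₗ combine σ)

omit hσ in
theorem act_mulVec (g : Matrix (Fin 2) (Fin 2) 𝕜) (x : Fin n ⊕ Fin 1 → ℝ) :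
    act σ g *ᵥ x = coord σ (g * combine σ x * gᴴ) :=
  LinearMap.toMatrix'_mulVec _ _

omit hσ in
theorem dact_mulVec (X : Matrix (Fin 2) (Fin 2) 𝕜) (x : Fin n ⊕ Fin 1 → ℝ) :
    dact σ X *ᵥ x = coord σ (X * combine σ x + combine σ x * Xᴴ) :=
  LinearMap.toMatrix'_mulVec _ _

omit hσ in
theorem dact_apply (X : Matrix (Fin 2) (Fin 2) 𝕜) (i j : Fin n ⊕ Fin 1) :
    dact σ X i j = coord σ (X * σ j + σ j * Xᴴ) i := by
  rw [← combine_single (σ := σ) j, ← dact_mulVec, mulVec_single_one]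
  rfl

theorem act_one : act σ 1 = 1 := by
  apply Matrix.ext_of_mulVec_single
  intro i
  rw [act_mulVec, Matrix.one_mul, conjTranspose_one, Matrix.mul_one, hσ.coord_combine, one_mulVec]

theorem act_mul (g h : Matrix (Fin 2) (Fin 2) 𝕜) : act σ (g * h) = act σ g * act σ h := by
  apply Matrix.ext_of_mulVec_single
  intro i
  rw [← mulVec_mulVec, act_mulVec, act_mulVec, act_mulVec, hσ.combine_coord, conjTranspose_mul]
  · simp only [Matrix.mul_assoc]
  · simp only [conjTranspose_mul, conjTranspose_conjTranspose, hσ.combine_isHermitian,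
      Matrix.mul_assoc]

theorem lie_dact (X Y : Matrix (Fin 2) (Fin 2) 𝕜) : dact σ ⁅X, Y⁆ = ⁅dact σ X, dact σ Y⁆ := by
  have hH : ∀ (X : Matrix (Fin 2) (Fin 2) 𝕜) x, (X * combine σ x + combine σ x * Xᴴ)ᴴ =
      X * combine σ x + combine σ x * Xᴴ := by
    intro X x
    rw [conjTranspose_add, conjTranspose_mul, conjTranspose_mul, conjTranspose_conjTranspose,
      hσ.combine_isHermitian, add_comm]
  apply Matrix.ext_of_mulVec_single
  intro i
  rw [Ring.lie_def, Ring.lie_def, sub_mulVec, ← mulVec_mulVec, ← mulVec_mulVec]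
  simp only [dact_mulVec]
  rw [hσ.combine_coord _ (hH X _), hσ.combine_coord _ (hH Y _), ← map_sub, conjTranspose_sub,
    conjTranspose_mul, conjTranspose_mul]
  congr 1
  noncomm_ring

/-- In coordinates, `exp(tX) N exp(tX*)` solves the linear system with matrix `dact σ X`. -/
theorem exp_dact (X : Matrix (Fin 2) (Fin 2) 𝕜) :
    act σ (NormedSpace.exp X) = NormedSpace.exp (dact σ X) := by
  let _ : NormedRing (Matrix (Fin 2) (Fin 2) 𝕜) := Matrix.linftyOpNormedRing
  let _ : NormedAlgebra ℝ (Matrix (Fin 2) (Fin 2) 𝕜) := Matrix.linftyOpNormedAlgebra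
  have hE : ∀ t : ℝ, (NormedSpace.exp (t • X) : Matrix (Fin 2) (Fin 2) 𝕜)ᴴ =
      NormedSpace.exp (t • Xᴴ) := by
    intro t
    rw [← Matrix.exp_conjTranspose, conjTranspose_smul, star_trivial]
  apply Matrix.ext_of_mulVec_single
  intro k
  set x : Fin n ⊕ Fin 1 → ℝ := Pi.single k 1
  set N := combine σ x with hN
  have h := exp_smul_mulVec_eq (dact σ X)
    (fun t => coord σ (NormedSpace.exp (t • X) * N * NormedSpace.exp (t • Xᴴ)))
    (by
      intro t i
      have h1 := ((hasDerivAt_exp_smul_const' (𝕂 := ℝ) X t).mul_const N).mul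
        (hasDerivAt_exp_smul_const (𝕂 := ℝ) Xᴴ t)
      have h2 := (LinearMap.toContinuousLinearMap
        (LinearMap.proj i ∘ₗ coord σ)).hasFDerivAt.comp_hasDerivAt t h1
      refine h2.congr_deriv ?_
      rw [dact_mulVec, hσ.combine_coord]
      · simp only [Matrix.mul_assoc]
        rfl
      · rw [← hE, conjTranspose_mul, conjTranspose_mul, conjTranspose_conjTranspose, hN,
          hσ.combine_isHermitian, Matrix.mul_assoc]) 1
  simp only [one_smul, zero_smul, NormedSpace.exp_zero, Matrix.one_mul, Matrix.mul_one] at h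
  rw [act_mulVec, ← Matrix.exp_conjTranspose, ← hN, ← h, hN, hσ.coord_combine]

theorem trace_mul_add (X : Matrix (Fin 2) (Fin 2) 𝕜) (i j : Fin n) :
    RCLike.re (trace (X * (σ (Sum.inl i) * σ (Sum.inl j) + σ (Sum.inl j) * σ (Sum.inl i)))) =
      (if i = j then 2 else 0) * RCLike.re (trace X) := by
  rw [hσ.anticomm, Matrix.mul_smul, Matrix.mul_one, trace_smul, RCLike.smul_re]

/-- Anticommutation turns the symmetric part of the spatial block into multiples of the traces of
`X` and `Xᴴ`, which vanish. The boost part is the image of the base point, the identity matrix. -/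
theorem dact_eq_gen {X : Matrix (Fin 2) (Fin 2) 𝕜} (hX : trace X = 0) :
    ∃ R, Rᵀ = -R ∧ dact σ X = gen R fun i => coord σ (X + Xᴴ) (Sum.inl i) := by
  have hX' : trace Xᴴ = 0 := by rw [trace_conjTranspose, hX, star_zero]
  refine ⟨of fun i j => dact σ X (Sum.inl i) (Sum.inl j), ?_, ?_⟩
  · ext i j
    simp only [transpose_apply, of_apply, dact_apply]
    change RCLike.re (trace _) / 2 = -(RCLike.re (trace _) / 2)
    have h1 := hσ.trace_mul_add X i j
    have h2 := hσ.trace_mul_add Xᴴ i j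
    rw [hX] at h1
    rw [hX'] at h2
    have e1 : trace (σ (Sum.inl j) * (X * σ (Sum.inl i))) =
        trace (X * (σ (Sum.inl i) * σ (Sum.inl j))) := by
      rw [trace_mul_comm, Matrix.mul_assoc]
    have e2 : trace (σ (Sum.inl i) * (X * σ (Sum.inl j))) =
        trace (X * (σ (Sum.inl j) * σ (Sum.inl i))) := by
      rw [trace_mul_comm, Matrix.mul_assoc]
    have e3 : trace (σ (Sum.inl j) * (σ (Sum.inl i) * Xᴴ)) =
        trace (Xᴴ * (σ (Sum.inl j) * σ (Sum.inl i))) := by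
      rw [← Matrix.mul_assoc, trace_mul_comm]
    have e4 : trace (σ (Sum.inl i) * (σ (Sum.inl j) * Xᴴ)) =
        trace (Xᴴ * (σ (Sum.inl i) * σ (Sum.inl j))) := by
      rw [← Matrix.mul_assoc, trace_mul_comm]
    rw [Matrix.mul_add, trace_add, map_add, map_zero, mul_zero] at h1 h2
    rw [Matrix.mul_add, Matrix.mul_add, trace_add, trace_add, e1, e2, e3, e4, map_add, map_add]
    linarith
  · ext (i | i) (j | j)
    · rfl
    · fin_cases j
      rw [dact_apply]
      change coord σ (X * σ (Sum.inr 0) + σ (Sum.inr 0) * Xᴴ) _ = coord σ (X + Xᴴ) _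
      rw [hσ.one, Matrix.mul_one, Matrix.one_mul]
    · fin_cases i
      rw [dact_apply]
      change RCLike.re (trace (σ (Sum.inr 0) * _)) / 2 = RCLike.re (trace _) / 2
      rw [hσ.one, Matrix.one_mul, Matrix.mul_add, trace_add, trace_add, trace_mul_comm X]
    · fin_cases i
      fin_cases j
      rw [dact_apply]
      change RCLike.re (trace (σ (Sum.inr 0) * (X * σ (Sum.inr 0) + σ (Sum.inr 0) * Xᴴ))) / 2 = 0
      rw [hσ.one, Matrix.mul_one, Matrix.one_mul, Matrix.one_mul, trace_add, hX, hX']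
      simp

theorem dact_eq_gen_of_isHermitian {X : Matrix (Fin 2) (Fin 2) 𝕜} (hX : trace X = 0)
    (h : Xᴴ = X) : dact σ X = gen 0 fun i => coord σ (X + X) (Sum.inl i) := by
  obtain ⟨R, -, hR⟩ := hσ.dact_eq_gen hX
  rw [hR, gen_inj, h]
  refine ⟨?_, rfl⟩
  ext i j
  have h1 : R i j = dact σ X (Sum.inl i) (Sum.inl j) := by rw [hR]; rfl
  rw [h1, dact_apply, h]
  change RCLike.re (trace _) / 2 = 0
  have h2 := hσ.trace_mul_add X i j
  rw [hX, map_zero, mul_zero, Matrix.mul_add, trace_add, map_add] at h2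
  rw [Matrix.mul_add, trace_add, map_add, trace_mul_comm (σ (Sum.inl i)) (X * _),
    ← Matrix.mul_assoc, trace_mul_comm _ X, Matrix.mul_assoc]
  linarith

theorem trace_combine (v : Fin n → ℝ) : trace (combine σ (vec v 0)) = 0 := by
  change trace (∑ j, vec v 0 j • σ j) = 0
  rw [trace_sum]
  refine Finset.sum_eq_zero fun j _ => ?_
  rcases j with j | j
  · rw [trace_smul, hσ.trace_eq_zero, smul_zero]
  · simp [vec]

theorem dact_combine (v : Fin n → ℝ) : dact σ ((2⁻¹ : ℝ) • combine σ (vec v 0)) = gen 0 v := by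
  rw [hσ.dact_eq_gen_of_isHermitian, gen_inj]
  · refine ⟨rfl, ?_⟩
    rw [← add_smul]
    norm_num
    rw [hσ.coord_combine]
    rfl
  · rw [trace_smul, hσ.trace_combine, smul_zero]
  · rw [conjTranspose_smul, hσ.combine_isHermitian, star_trivial]

theorem add_conjTranspose_eq_zero {X : Matrix (Fin 2) (Fin 2) 𝕜} (hX : trace X = 0)
    (h : ∀ i, coord σ (X + Xᴴ) (Sum.inl i) = 0) : X + Xᴴ = 0 := by
  apply hσ.eq_zero_of_coord
  · rw [conjTranspose_add, conjTranspose_conjTranspose, add_comm]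
  · funext i
    rcases i with i | i
    · exact h i
    · fin_cases i
      change RCLike.re (trace (σ (Sum.inr 0) * _)) / 2 = 0
      rw [hσ.one, Matrix.one_mul, trace_add, trace_conjTranspose, hX]
      simp

/-- Acting on the identity gives `Xᴴ = -X`; the action on `σ j` then becomes a commutator, so `X`
commutes with the whole basis. -/
theorem eq_zero_of_dact {X : Matrix (Fin 2) (Fin 2) 𝕜} (hX : trace X = 0) (h : dact σ X = 0) :
    X = 0 := by
  have h1 : ∀ j, X * σ j + σ j * Xᴴ = 0 := by
    intro j
    apply hσ.eq_zero_of_coord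
    · rw [conjTranspose_add, conjTranspose_mul, conjTranspose_mul, conjTranspose_conjTranspose,
        hσ.isHermitian, add_comm]
    · funext i
      rw [← dact_apply, h]
      rfl
  have h2 := h1 (Sum.inr 0)
  rw [hσ.one, Matrix.mul_one, Matrix.one_mul] at h2
  refine hσ.central X (fun j => ?_) hX
  have h3 := h1 j
  rw [← neg_eq_of_add_eq_zero_right h2, Matrix.mul_neg, ← sub_eq_add_neg] at h3
  exact sub_eq_zero.1 h3

omit hσ in
/-- The derived representation, on the Lie algebra of `SL(2)`. -/
noncomputable def drep (hσ : IsPauliBasis σ) :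
    lieAlg (⊤ : Subgroup (SpecialLinearGroup (Fin 2) 𝕜)) →ₗ⁅ℝ⁆
      Matrix (Fin n ⊕ Fin 1) (Fin n ⊕ Fin 1) ℝ where
  toFun X := dact σ X.1
  map_add' X Y := by
    apply Matrix.ext_of_mulVec_single
    intro i
    rw [add_mulVec, dact_mulVec, dact_mulVec, dact_mulVec, ← map_add]
    congr 1
    push_cast
    rw [conjTranspose_add]
    noncomm_ring
  map_smul' c X := by
    apply Matrix.ext_of_mulVec_single
    intro i
    rw [RingHom.id_apply, smul_mulVec, dact_mulVec, dact_mulVec, ← map_smul]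
    congr 1
    push_cast
    rw [conjTranspose_smul, star_trivial, Matrix.smul_mul, Matrix.mul_smul, smul_add]
  map_lie' {X Y} := hσ.lie_dact X.1 Y.1

/-- Halves of Hermitian traceless matrices give all boosts, brackets of boosts give all `wedge u w`,
and these span the skew matrices. -/
theorem exists_drep_eq {R : Matrix (Fin n) (Fin n) ℝ} (hR : Rᵀ = -R) (v : Fin n → ℝ) :
    ∃ X, hσ.drep X = gen R v := by
  have hb : ∀ v, gen 0 v ∈ hσ.drep.range := by
    intro v
    refine (LieHom.mem_range _ _).2 ⟨⟨(2⁻¹ : ℝ) • combine σ (vec v 0), mem_lieAlg_top.2 ?_⟩, ?_⟩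
    · rw [trace_smul, hσ.trace_combine, smul_zero]
    · exact hσ.dact_combine v
  have hw : ∀ u w : Fin n → ℝ, gen (wedge u w) 0 ∈ hσ.drep.range := by
    intro u w
    have h := hσ.drep.range.lie_mem (hb u) (hb w)
    rw [lie_gen (by simp) (by simp)] at h
    simpa using h
  let S : Submodule ℝ (Matrix (Fin n) (Fin n) ℝ) :=
    { carrier := {R | gen R 0 ∈ hσ.drep.range}
      zero_mem' := by
        change gen 0 0 ∈ hσ.drep.range
        rw [gen_zero]
        exact zero_mem _
      add_mem' := fun {R R'} h h' => by
        have := hσ.drep.range.add_mem h h'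
        rw [gen_add, add_zero] at this
        exact this
      smul_mem' := fun c R h => by
        have := hσ.drep.range.smul_mem c h
        rw [smul_gen, smul_zero] at this
        exact this }
  have hRS : R ∈ S := by
    have hsum : R = ∑ i, ∑ j, (R i j / 2) • wedge (Pi.single i 1) (Pi.single j 1) := by
      ext k l
      have h := congrFun (congrFun hR k) l
      rw [transpose_apply, Matrix.neg_apply] at h
      simp only [Matrix.sum_apply, Matrix.smul_apply, wedge, Matrix.sub_apply, vecMulVec_apply, Pi.single_apply,
        smul_eq_mul, mul_sub, Finset.sum_sub_distrib]
      simp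
      linarith
    rw [hsum]
    exact Submodule.sum_mem _ fun i _ => Submodule.sum_mem _ fun j _ =>
      S.smul_mem _ (hw _ _)
  have h := hσ.drep.range.add_mem (x := gen R 0) hRS (hb v)
  rw [gen_add, add_zero, zero_add] at h
  exact (LieHom.mem_range _ _).1 h

/-- The representation of `SL(2)` on Hermitian matrices. -/
noncomputable def model :
    LorentzModel (⊤ : Subgroup (SpecialLinearGroup (Fin 2) 𝕜)) n where
  rep :=
    { toFun := fun g => act σ g.1.1
      map_one' := hσ.act_one
      map_mul' := fun g h => hσ.act_mul g.1.1 h.1.1 }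
  drep := hσ.drep
  inj := by
    intro X Y hXY
    rw [← sub_eq_zero] at hXY ⊢
    rw [← map_sub] at hXY
    exact Subtype.ext (hσ.eq_zero_of_dact (mem_lieAlg_top.1 (X - Y).2) hXY)
  exists_eq_gen X := by
    obtain ⟨R, hR, h⟩ := hσ.dact_eq_gen (mem_lieAlg_top.1 X.2)
    exact ⟨R, _, hR, h⟩
  surj R v hR := hσ.exists_drep_eq hR v
  mem_k₀ X := by
    obtain ⟨R, hR, h⟩ := hσ.dact_eq_gen (mem_lieAlg_top.1 X.2)
    change X.1ᴴ = -X.1 ↔ ∃ R, dact σ X.1 = gen R 0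
    constructor
    · intro hX
      refine ⟨R, ?_⟩
      rw [h, gen_inj]
      refine ⟨rfl, ?_⟩
      rw [hX, add_neg_cancel, map_zero]
      rfl
    · rintro ⟨S, hS⟩
      rw [h, gen_inj] at hS
      exact (neg_eq_of_add_eq_zero_right (hσ.add_conjTranspose_eq_zero (mem_lieAlg_top.1 X.2)
        fun i => congrFun hS.2 i)).symm
  mem_s₀ X := by
    change X.1ᴴ = X.1 ↔ ∃ v, dact σ X.1 = gen 0 v
    constructor
    · intro hX
      exact ⟨_, hσ.dact_eq_gen_of_isHermitian (mem_lieAlg_top.1 X.2) hX⟩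
    · rintro ⟨v, hv⟩
      let Y : lieAlg (⊤ : Subgroup (SpecialLinearGroup (Fin 2) 𝕜)) :=
        ⟨(2⁻¹ : ℝ) • combine σ (vec v 0), mem_lieAlg_top.2 (by
          rw [trace_smul, hσ.trace_combine, smul_zero])⟩
      -- The same boost is the image of the Hermitian matrix `Y`, so injectivity forces `X = Y`.
      have h0 : hσ.drep (X - Y) = 0 := by
        rw [map_sub, sub_eq_zero]
        exact hv.trans (hσ.dact_combine v).symm
      have h1 : X.1 - Y.1 = 0 := hσ.eq_zero_of_dact (mem_lieAlg_top.1 (X - Y).2) h0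
      rw [sub_eq_zero.1 h1, conjTranspose_smul, hσ.combine_isHermitian, star_trivial]
  exists_exp X := by
    have h := det_exp_smul_eq_one (mem_lieAlg_top.1 X.2) 1
    rw [one_smul] at h
    exact ⟨⟨⟨_, h⟩, Subgroup.mem_top _⟩, rfl, hσ.exp_dact X.1⟩
  orbit g := by
    obtain ⟨ξ, t, h⟩ := vec_surj (act σ g.1.1 *ᵥ vec 0 1)
    refine ⟨ξ, t, h, ?_⟩
    rw [act_mulVec, vec_zero_one, combine_single, hσ.one, Matrix.mul_one] at h
    -- The base point moves to `g gᴴ`. Its determinant one places it on the hyperboloid, and its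
    -- nonnegative trace selects the upper sheet.
    have hdet : (g.1.1 * g.1.1ᴴ).det = 1 := by
      rw [det_mul, det_conjTranspose, g.1.2, star_one, one_mul]
    have h1 := hσ.re_det (g.1.1 * g.1.1ᴴ) (by
      rw [conjTranspose_mul, conjTranspose_conjTranspose])
    rw [hdet, RCLike.one_re, h] at h1
    have ht : t = RCLike.re (trace (g.1.1 * g.1.1ᴴ)) / 2 := by
      have h2 := congrFun h (Sum.inr 0)
      change RCLike.re (trace (σ (Sum.inr 0) * _)) / 2 = t at h2
      rw [hσ.one, Matrix.one_mul] at h2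
      exact h2.symm
    have ht0 : 0 ≤ t := by
      rw [ht, trace_fin_two]
      simp only [Matrix.mul_apply, Fin.sum_univ_two, conjTranspose_apply, RCLike.star_def,
        RCLike.mul_conj, ← RCLike.ofReal_pow, ← RCLike.ofReal_add, RCLike.ofReal_re]
      positivity
    have hs : t ^ 2 = 1 + ξ ⬝ᵥ ξ := by
      simp only [vec, Sum.elim_inl, Sum.elim_inr] at h1
      simp only [dotProduct, ← sq]
      linarith
    refine ⟨lt_of_le_of_ne ht0 ?_, hs⟩
    rintro rfl
    have h3 : 0 ≤ ξ ⬝ᵥ ξ := Finset.sum_nonneg fun i _ => mul_self_nonneg _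
    linarith
  stab g h := by
    change act σ g.1.1 *ᵥ vec 0 1 = vec 0 1 at h
    rw [act_mulVec, vec_zero_one, combine_single, hσ.one, Matrix.mul_one, ← hσ.coord_self, hσ.one] at h
    have h1 : g.1.1 * g.1.1ᴴ = 1 := by
      rw [← hσ.combine_coord (g.1.1 * g.1.1ᴴ) (by
        rw [conjTranspose_mul, conjTranspose_conjTranspose]), h,
        hσ.combine_coord 1 conjTranspose_one]
    change g.1.1 ∈ unitary (Matrix (Fin 2) (Fin 2) 𝕜)
    rw [Unitary.mem_iff, star_eq_conjTranspose]
    exact ⟨mul_eq_one_comm.1 h1, h1⟩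

end IsPauliBasis

end SL2

/-! ### Pauli bases of the real symmetric and complex Hermitian `2 × 2` matrices. -/

section Pauli

/-- Commuting with the diagonal matrix kills the off-diagonal entries; commuting with the swap
equates the diagonal ones, and the trace removes them. -/
theorem eq_zero_of_commute {𝕜 : Type} [RCLike 𝕜] {X : Matrix (Fin 2) (Fin 2) 𝕜}
    (h : X * !![1, 0; 0, -1] = !![1, 0; 0, -1] * X) (h' : X * !![0, 1; 1, 0] = !![0, 1; 1, 0] * X)
    (hX : trace X = 0) : X = 0 := by
  rw [eta_fin_two X] at h h'
  simp only [mul_fin_two, ← Matrix.ext_iff, Fin.forall_fin_two] at h h'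
  simp at h h'
  rw [trace_fin_two] at hX
  have h01 : X 0 1 = 0 := by linear_combination (-1 / 2 : 𝕜) * h.1
  have h10 : X 1 0 = 0 := by linear_combination (1 / 2 : 𝕜) * h.2
  have h00 : X 0 0 = 0 := by linear_combination (1 / 2 : 𝕜) * hX + (1 / 2 : 𝕜) * h'.1.2
  have h11 : X 1 1 = 0 := by linear_combination hX - h00
  ext i j
  fin_cases i <;> fin_cases j <;> assumption

/-- The identity and two symmetric traceless matrices. -/
def pauliReal : Fin 2 ⊕ Fin 1 → Matrix (Fin 2) (Fin 2) ℝ :=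
  Sum.elim ![!![1, 0; 0, -1], !![0, 1; 1, 0]] fun _ => 1

theorem isPauliBasis_pauliReal : IsPauliBasis pauliReal where
  isHermitian i := by
    rcases i with i | i
    · fin_cases i <;> ext j k <;> fin_cases j <;> fin_cases k <;> simp [pauliReal]
    · simp [pauliReal]
  one := rfl
  anticomm i j := by
    fin_cases i <;> fin_cases j <;> ext k l <;> fin_cases k <;> fin_cases l <;>
      norm_num [pauliReal]
  trace_eq_zero i := by fin_cases i <;> simp [pauliReal, trace_fin_two]
  coord_self j := by
    funext k
    rcases j with j | j <;> rcases k with k | k <;> fin_cases j <;> fin_cases k <;>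
      simp [pauliReal, coord, trace_fin_two]
  combine_coord N hN := by
    have h := congrFun (congrFun hN 0) 1
    simp at h
    ext i j
    fin_cases i <;> fin_cases j <;>
      simp [pauliReal, coord, combine, trace_fin_two, Matrix.mul_apply, h] <;> ring
  re_det N hN := by
    have h := congrFun (congrFun hN 0) 1
    simp at h
    simp [pauliReal, coord, trace_fin_two, det_fin_two, Matrix.mul_apply, h]
    ring
  central X h hX := eq_zero_of_commute (h (Sum.inl 0)) (h (Sum.inl 1)) hX

/-- The identity and the three Pauli matrices. -/
noncomputable def pauliComplex : Fin 3 ⊕ Fin 1 → Matrix (Fin 2) (Fin 2) ℂ :=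
  Sum.elim ![!![1, 0; 0, -1], !![0, 1; 1, 0], !![0, -Complex.I; Complex.I, 0]] fun _ => 1

theorem isPauliBasis_pauliComplex : IsPauliBasis pauliComplex where
  isHermitian i := by
    rcases i with i | i
    · fin_cases i <;> ext j k <;> fin_cases j <;> fin_cases k <;> simp [pauliComplex]
    · simp [pauliComplex]
  one := rfl
  anticomm i j := by
    fin_cases i <;> fin_cases j <;> ext k l <;> fin_cases k <;> fin_cases l <;>
      norm_num [pauliComplex]
  trace_eq_zero i := by fin_cases i <;> simp [pauliComplex, trace_fin_two]
  coord_self j := by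
    funext k
    rcases j with j | j <;> rcases k with k | k <;> fin_cases j <;> fin_cases k <;>
      simp [pauliComplex, coord, trace_fin_two]
  combine_coord N hN := by
    have h00 := congrFun (congrFun hN 0) 0
    have h01 := congrFun (congrFun hN 0) 1
    have h11 := congrFun (congrFun hN 1) 1
    simp [Complex.ext_iff] at h00 h01 h11
    ext i j
    fin_cases i <;> fin_cases j <;> apply Complex.ext <;>
      simp [pauliComplex, coord, combine, trace_fin_two, Matrix.mul_apply, Fin.sum_univ_three] <;>
      linarith
  re_det N hN := by
    have h00 := congrFun (congrFun hN 0) 0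
    have h01 := congrFun (congrFun hN 0) 1
    have h11 := congrFun (congrFun hN 1) 1
    simp [Complex.ext_iff] at h00 h01 h11
    have e1 : (N 0 0).im = 0 := by linarith
    have e2 : (N 1 1).im = 0 := by linarith
    have e3 : (N 1 0).im = -(N 0 1).im := by linarith [h01.2]
    simp [pauliComplex, coord, trace_fin_two, det_fin_two, Matrix.mul_apply, Fin.sum_univ_three,
      e1, e2, e3, h01.1]
    ring
  central X h hX := eq_zero_of_commute (h (Sum.inl 0)) (h (Sum.inl 1)) hX

end Pauli

end TripleSpace

open TripleSpace in
theorem corollary6p4 {𝕜 : Type} [RCLike 𝕜] {ι : Type} [Fintype ι] [DecidableEq ι]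
    (G₀ : Subgroup (Matrix.SpecialLinearGroup ι 𝕜)) (hG₀ : IsListed G₀) :
    (∃ a : Fin 3 → Submodule ℝ (lieAlg G₀), IsPlanarTriple G₀ a) ∧
    ∀ a : Fin 3 → Submodule ℝ (lieAlg G₀), IsPlanarTriple G₀ a →
      IsMaximalAbelianIn (prod₃ fun _ => s₀ G₀) (prod₃ a) ∧
      PolarDecomposition G₀ (prod₃ a) ∧
      ∀ p : Submodule ℝ (Fin 3 → lieAlg G₀),
        IsMinimalParabolic (prod₃ fun _ => k₀ G₀) (prod₃ fun _ => s₀ G₀) p →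
        prod₃ a ≤ p → SphericalDecomposition G₀ p := by
  cases hG₀ with
  | sl2R => exact isPauliBasis_pauliReal.model.polar_and_spherical_decomposition le_rfl
  | sl2C => exact isPauliBasis_pauliComplex.model.polar_and_spherical_decomposition (by norm_num)
  | soe n hn => exact (modelSOe n).polar_and_spherical_decomposition hn
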